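/- Let $R$ be a commutative ring with identity. An ideal of $R$ is called *semi-regular* if it contains a finitely generated ideal $J$ that is dense, i.e. $(0:_R J)=\{r\in R: rJ=0\}=0$. An $R$-module $M$ is *semi-regular flat* if $\mathrm{Tor}_1^R(R/I,M)=0$, and *semi-regular coflat* if $\mathrm{Ext}^1_R(R/I,M)=0$, for every finitely generated semi-regular ideal $I$ of $R$. The ring $R$ is *semi-regular coherent* if every finitely generated semi-regular ideal of $R$ is finitely presented. A submodule $K\subseteq N$ is *pure* if $X\otimes_R K\to X\otimes_R N$ is injective for every $R$-module $X$; a *pure quotient* of $N$ is a module $N/K$ with $K$ pure in $N$. For a class $\mathcal C$ of $R$-modules, a *$\mathcal C$-precover* of a module $M$ is a homomorphism $f:F\to M$ with $F\in\mathcal C$ such that every homomorphism $F'\to M$ with $F'\in\mathcal C$ factors through $f$; it is a *$\mathcal C$-cover* if moreover every endomorphism $h$ of $F$ with $fh=f$ is an automorphism; $\mathcal C$ is *precovering* (*covering*) if every $R$-module has a $\mathcal C$-precover ($\mathcal C$-cover). **Theorem.** The following statements are equivalent: 1. $R$ is semi-regular coherent; 2. every direct product of semi-regular flat $R$-modules is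 semi-regular flat; 3. every direct product of flat $R$-modules is semi-regular flat; 4. every direct product of copies of $R$ is semi-regular flat; 5. every direct limit (over a directed set) of semi-regular coflat $R$-modules is semi-regular coflat; 6. every pure quotient of a semi-regular coflat $R$-module is semi-regular coflat; 7. the class of semi-regular coflat $R$-modules is precovering; 8. the class of semi-regular coflat $R$-modules is covering; 9. $\mathrm{Hom}_R(N,E)$ is semi-regular flat for every semi-regular coflat $R$-module $N$ and every injective $R$-module $E$; 10. for every injective cogenerator $E$ and every semi-regular coflat $R$-module $N$, $\mathrm{Hom}_R(N,E)$ is semi-regular flat; 11. $\mathrm{Hom}_R(\mathrm{Hom}_R(M,E_1),E_2)$ is semi-regular flat for every semi-regular flat $R$-module $M$ and all injective $R$-modules $E_1$ and $E_2$; 12. for all injective cogenerators $E_1$ and $E_2$ and every semi-regular flat $R$-module $M$, $\mathrm{Hom}_R(\mathrm{Hom}_R(M,E_1),E_2)$ is semi-regular flat. -/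

import Mathlib

universe u

open CategoryTheory

section Ideals

variable {R : Type u} [CommRing R]

/-- An ideal `J` is dense if `(0 :_R J) = {r | r J = 0}` is zero. -/
def Ideal.IsDenseIdeal (J : Ideal R) : Prop :=
  Submodule.annihilator J = ⊥

/-- An ideal is semi-regular if it contains a finitely generated dense ideal. -/
def Ideal.IsSemiregular (I : Ideal R) : Prop :=
  ∃ J : Ideal R, J ≤ I ∧ J.FG ∧ J.IsDenseIdeal

end Ideals

/-- Every finitely generated semi-regular ideal is finitely presented as a module. -/
def IsSemiregularCoherent (R : Type u) [CommRing R] : Prop :=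
  ∀ I : Ideal R, I.FG → I.IsSemiregular → Module.FinitePresentation R I

/-- `Tor₁(R/I, M) = 0` for every finitely generated semi-regular ideal `I`. -/
def IsSemiregularFlat (R : Type u) [CommRing R] (M : Type u) [AddCommGroup M] [Module R M] :
    Prop :=
  ∀ I : Ideal R, I.FG → I.IsSemiregular →
    Limits.IsZero (((Tor (ModuleCat.{u} R) 1).obj (ModuleCat.of R (R ⧸ I))).obj (ModuleCat.of R M))

/-- `Ext¹(R/I, M) = 0` for every finitely generated semi-regular ideal `I`. -/
def IsSemiregularCoflat (R : Type u) [CommRing R] (M : Type u) [AddCommGroup M] [Module R M] :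
    Prop :=
  ∀ I : Ideal R, I.FG → I.IsSemiregular →
    Subsingleton (Abelian.Ext (ModuleCat.of R (R ⧸ I)) (ModuleCat.of R M) 1)

/-- The class of semi-regular coflat modules. -/
def semiregularCoflatClass (R : Type u) [CommRing R] : ObjectProperty (ModuleCat.{u} R) :=
  fun M => IsSemiregularCoflat R M

/-- A submodule `K ⊆ N` is pure if `X ⊗ K → X ⊗ N` is injective for every module `X`. -/
def Submodule.IsPureSubmodule {R : Type u} [CommRing R] {N : Type u} [AddCommGroup N] [Module R N]
    (K : Submodule R N) : Prop :=
  ∀ (X : Type u) [AddCommGroup X] [Module R X], Function.Injective (K.subtype.lTensor X)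

/-- `E` is an injective cogenerator of the category of `R`-modules. -/
def IsInjectiveCogenerator (R : Type u) [CommRing R] (E : Type u) [AddCommGroup E] [Module R E] :
    Prop :=
  Module.Injective R E ∧ IsCoseparator (ModuleCat.of R E)

section Covers

variable {R : Type u} [CommRing R]

/-- `f : F ⟶ M` is a `C`-precover of `M`: `F` belongs to `C`, and every morphism to `M` from a
module in `C` factors through `f`. -/
def IsPrecover (C : ObjectProperty (ModuleCat.{u} R)) {F M : ModuleCat.{u} R} (f : F ⟶ M) : Prop :=
  C F ∧ ∀ (F' : ModuleCat.{u} R) (g : F' ⟶ M), C F' → ∃ h : F' ⟶ F, h ≫ f = g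

/-- A `C`-cover is a `C`-precover `f` such that every endomorphism `h` with `f ∘ h = f` is an
automorphism. -/
def IsCover (C : ObjectProperty (ModuleCat.{u} R)) {F M : ModuleCat.{u} R} (f : F ⟶ M) : Prop :=
  IsPrecover C f ∧ ∀ h : F ⟶ F, h ≫ f = f → IsIso h

/-- Every module has a `C`-precover. -/
def IsPrecoveringClass (C : ObjectProperty (ModuleCat.{u} R)) : Prop :=
  ∀ M : ModuleCat.{u} R, ∃ (F : ModuleCat.{u} R) (f : F ⟶ M), IsPrecover C f

/-- Every module has a `C`-cover. -/
def IsCoveringClass (C : ObjectProperty (ModuleCat.{u} R)) : Prop :=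
  ∀ M : ModuleCat.{u} R, ∃ (F : ModuleCat.{u} R) (f : F ⟶ M), IsCover C f

end Covers

/-! For an ideal I generated by a finite family x, both homological conditions are linear algebra.
`Tor₁(R/I, M) = 0` says that every relation ∑ xᵢvᵢ = 0 in M comes from relations of x in R
(`isZero_tor_one_iff`). `Ext¹(R/I, M) = 0` says that every tuple in M obeying all relations of x has
the form xᵢz (`subsingleton_ext_quotient_iff`, `solvesCompatible_iff_extends`). Finite presentation
of I says that the module K of relations of x is finitely generated.

If finitely many rows generate K, both conditions become finite linear systems of a fixed shape.
Such systems can be solved coordinatewise in products, dualized into injectives, descended along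
pure quotients and decided at one stage of a direct limit.

Conversely, on the flat side, the elements of K form one tautological relation in R^K, and
trivializing it exhibits finitely many generators of K. The bidual statement reaches R^ι because a
relation in R^ι lifts to the bidual of R^(ι), taken with respect to the character module of R, and
its trivialization descends again.

On the coflat side, suppose K is not finitely generated. Then K is the union of a well-ordered chain
of proper submodules L_j. Embed R^n/L_j in an injective G_j. Modulo eventually vanishing families,
the standard basis gives a tuple in ∏ G_j that obeys all relations of x but is no multiple of x
(`ReducedProductsCoflat.isSemiregularCoherent`). So coherence follows once such reduced products are
coflat. They are pure quotients of products and also direct limits. From precovers one gets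
coflatness by a tree and counting argument, which makes the reduced product a retract of its
precover (`isSemiregularCoflat_reducedProduct_of_precover`).

Finally, coherence gives covers. Large modules contain nonzero pure submodules inside the kernel of
any map to a small module (`exists_isEquationallyPure_le_ker`), so maps from coflat modules factor
through coflat quotients of bounded size, and precovers exist. Closure under direct limits upgrades
them to covers by a transfinite chain of worst possible maps (`DirectLimitsCoflat.isCoveringClass`).
-/

/-! ### Equational form of coflatness -/

section Equational

variable {R : Type u} [CommRing R]

/-- Every relation `∑ x i • v i = 0` with values in `M` and fixed coefficients `x` is trivial. -/
def TrivializesRelations {n : ℕ} (x : Fin n → R) (M : Type u) [AddCommGroup M] [Module R M] :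
    Prop :=
  ∀ v : Fin n → M, ∑ i, x i • v i = 0 → Module.IsTrivialRelation x v

/-- Every family `y` satisfying all the linear relations satisfied by `x` is of the form
`i ↦ x i • z`. -/
def SolvesCompatible {n : ℕ} (x : Fin n → R) (M : Type u) [AddCommGroup M] [Module R M] : Prop :=
  ∀ y : Fin n → M, (∀ c : Fin n → R, ∑ i, c i * x i = 0 → ∑ i, c i • y i = 0) →
    ∃ z : M, ∀ i, y i = x i • z

theorem LinearMap.exists_range_factor {A B C : Type*} [AddCommGroup A] [Module R A]
    [AddCommGroup B] [Module R B] [AddCommGroup C] [Module R C] (q : A →ₗ[R] B) (φ : A →ₗ[R] C)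
    (h : LinearMap.ker q ≤ LinearMap.ker φ) :
    ∃ ψ : LinearMap.range q →ₗ[R] C, ∀ a (ha : q a ∈ LinearMap.range q), ψ ⟨q a, ha⟩ = φ a := by
  refine ⟨((LinearMap.ker q).liftQ φ h).comp q.quotKerEquivRange.symm.toLinearMap, fun a ha => ?_⟩
  have : q.quotKerEquivRange.symm ⟨q a, ha⟩ = Submodule.Quotient.mk a := by
    rw [LinearEquiv.symm_apply_eq]; rfl
  simp [this]

/-- This is the form of injectivity suited to equations in Hom modules: with `q` the coefficient
map, only consistency on its kernel has to be checked. -/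
theorem Module.Injective.exists_factor {A B E : Type u} [AddCommGroup A] [Module R A]
    [AddCommGroup B] [Module R B] [AddCommGroup E] [Module R E] (hE : Module.Injective R E)
    (q : A →ₗ[R] B) (φ : A →ₗ[R] E) (h : ∀ a, q a = 0 → φ a = 0) :
    ∃ ψ : B →ₗ[R] E, ∀ a, ψ (q a) = φ a := by
  obtain ⟨ψ, hψ⟩ := q.exists_range_factor φ (fun a ha => h a ha)
  obtain ⟨χ, hχ⟩ := hE.out (LinearMap.range q).subtype (Submodule.injective_subtype _) ψ
  exact ⟨χ, fun a => (hχ ⟨q a, a, rfl⟩).trans (hψ a _)⟩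

theorem Ideal.mem_span_range_iff_exists_sum {n : ℕ} {x : Fin n → R} {a : R} :
    a ∈ Ideal.span (Set.range x) ↔ ∃ c : Fin n → R, ∑ i, c i * x i = a := by
  simpa using Ideal.mem_span_range_iff_exists_fun (x := a) (v := x)

/-- The linear map on the ideal generated by `x` determined by a compatible family of values. -/
theorem Ideal.exists_linearMap_of_compatible {n : ℕ} {x : Fin n → R} {M : Type u}
    [AddCommGroup M] [Module R M] {y : Fin n → M}
    (hy : ∀ c : Fin n → R, ∑ i, c i * x i = 0 → ∑ i, c i • y i = 0) :
    ∃ f : Ideal.span (Set.range x) →ₗ[R] M,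
      ∀ i (hi : x i ∈ Ideal.span (Set.range x)), f ⟨x i, hi⟩ = y i := by
  classical
  let q := Fintype.linearCombination R x
  have hr : LinearMap.range q = Ideal.span (Set.range x) := Fintype.range_linearCombination R x
  obtain ⟨ψ, hψ⟩ := q.exists_range_factor (Fintype.linearCombination R y) (fun c hc => by
    have := hy c (by simpa [q, Fintype.linearCombination_apply] using hc)
    simpa [Fintype.linearCombination_apply] using this)
  refine ⟨ψ.comp (LinearEquiv.ofEq _ _ hr.symm).toLinearMap, fun i hi => ?_⟩
  have h1 : q (Pi.single i 1) = x i := by simp [q]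
  have h2 := hψ (Pi.single i 1) ⟨_, rfl⟩
  have h3 : (⟨x i, hr ▸ hi⟩ : LinearMap.range q) = ⟨q (Pi.single i 1), ⟨_, rfl⟩⟩ :=
    Subtype.ext h1.symm
  have h4 : (LinearEquiv.ofEq _ _ hr.symm) ⟨x i, hi⟩ =
    (⟨x i, hr ▸ hi⟩ : LinearMap.range q) := rfl
  rw [LinearMap.comp_apply, LinearEquiv.coe_coe, h4, h3, h2]
  simp

/-- A homomorphism on the ideal is a tuple of values respecting the relations of `x`. It extends to
R exactly when it is multiplication by some z, the image of 1. -/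
theorem solvesCompatible_iff_extends {n : ℕ} {x : Fin n → R} {M : Type u}
    [AddCommGroup M] [Module R M] :
    SolvesCompatible x M ↔ ∀ f : Ideal.span (Set.range x) →ₗ[R] M,
      ∃ z : M, ∀ a, f a = (a : R) • z := by
  have hx : ∀ i, x i ∈ Ideal.span (Set.range x) := fun i => Ideal.subset_span ⟨i, rfl⟩
  constructor
  · intro h f
    obtain ⟨z, hz⟩ := h (fun i => f ⟨x i, hx i⟩) (fun c hc => by
      rw [← map_zero f]
      simp_rw [← map_smul]
      rw [← map_sum]
      congr 1
      ext
      simpa using hc)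
    refine ⟨z, fun a => ?_⟩
    obtain ⟨a, ha⟩ := a
    obtain ⟨c, rfl⟩ := Ideal.mem_span_range_iff_exists_sum.1 ha
    have : (⟨∑ i, c i * x i, ha⟩ : Ideal.span (Set.range x)) = ∑ i, c i • ⟨x i, hx i⟩ := by
      ext; simp
    conv_lhs => rw [this, map_sum]
    simp_rw [map_smul, hz, smul_smul]
    rw [Finset.sum_smul]
  · intro h y hy
    obtain ⟨f, hf⟩ := Ideal.exists_linearMap_of_compatible hy
    obtain ⟨z, hz⟩ := h f
    exact ⟨z, fun i => by rw [← hf i (hx i), hz]⟩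

/-- Long exact sequence of 0 → I → R → R/I → 0: since R is projective, `Ext¹(R/I, M)` is the
cokernel of Hom(R, M) → Hom(I, M). -/
theorem subsingleton_ext_quotient_iff (I : Ideal R) (M : Type u) [AddCommGroup M] [Module R M] :
    Subsingleton (Abelian.Ext (ModuleCat.of R (R ⧸ I)) (ModuleCat.of R M) 1) ↔
      ∀ f : I →ₗ[R] M, ∃ z : M, ∀ a, f a = (a : R) • z := by
  let S : ShortComplex (ModuleCat.{u} R) := ShortComplex.mk
    (ModuleCat.ofHom I.subtype) (ModuleCat.ofHom I.mkQ) (by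
      ext x
      exact (Submodule.Quotient.mk_eq_zero I).2 x.2)
  have hS : S.ShortExact := by
    have : Mono S.f := (ModuleCat.mono_iff_injective _).2 (Submodule.injective_subtype _)
    have : Epi S.g := (ModuleCat.epi_iff_surjective _).2 (Submodule.mkQ_surjective _)
    refine ⟨(ShortComplex.moduleCat_exact_iff _).2 fun x hx => ?_⟩
    exact ⟨⟨x, (Submodule.Quotient.mk_eq_zero I).1 hx⟩, rfl⟩
  have : Projective S.X₂ := (ModuleCat.projective_of_free (M := ModuleCat.of R R)
    (Module.Basis.singleton Unit R))
  constructor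
  · intro h f
    obtain ⟨x₂, hx₂⟩ := Abelian.Ext.contravariant_sequence_exact₁ hS (ModuleCat.of R M)
      (Abelian.Ext.mk₀ (ModuleCat.ofHom f)) (n₁ := 1) rfl (Subsingleton.elim (α :=
        Abelian.Ext (ModuleCat.of R (R ⧸ I)) (ModuleCat.of R M) 1) _ _)
    obtain ⟨g, rfl⟩ := (Abelian.Ext.mk₀_bijective _ _).2 x₂
    rw [Abelian.Ext.mk₀_comp_mk₀] at hx₂
    have h1 := (Abelian.Ext.mk₀_bijective _ _).1 hx₂
    refine ⟨g.hom (1 : R), fun a => ?_⟩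
    have h2 : g.hom (a : R) = f a := congrArg (fun k => k.hom a) h1
    rw [← map_smul, ← h2]
    simp
  · intro h
    refine ⟨fun a b => ?_⟩
    suffices H : ∀ a : Abelian.Ext (ModuleCat.of R (R ⧸ I)) (ModuleCat.of R M) 1, a = 0 by
      rw [H a, H b]
    intro a
    obtain ⟨x₁, rfl⟩ := Abelian.Ext.contravariant_sequence_exact₃ hS (ModuleCat.of R M) a
      (Abelian.Ext.eq_zero_of_projective _) (n₀ := 0) rfl
    obtain ⟨f, rfl⟩ := (Abelian.Ext.mk₀_bijective _ _).2 x₁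
    obtain ⟨z, hz⟩ := h f.hom
    have : f = S.f ≫ ModuleCat.ofHom (LinearMap.toSpanSingleton R M z) := by
      ext a
      exact hz a
    rw [this, ← Abelian.Ext.mk₀_comp_mk₀, ← Abelian.Ext.comp_assoc_of_second_deg_zero,
      ShortComplex.ShortExact.extClass_comp, Abelian.Ext.zero_comp]

theorem isSemiregularCoflat_iff {M : Type u} [AddCommGroup M] [Module R M] :
    IsSemiregularCoflat R M ↔ ∀ (n : ℕ) (x : Fin n → R),
      (Ideal.span (Set.range x)).IsSemiregular → SolvesCompatible x M := by
  constructor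
  · intro h n x hx
    rw [solvesCompatible_iff_extends, ← subsingleton_ext_quotient_iff]
    exact h _ ⟨(Set.finite_range x).toFinset, by simp⟩ hx
  · intro h I hI hI'
    obtain ⟨n, x, rfl⟩ := Submodule.fg_iff_exists_fin_generating_family.1 hI
    rw [subsingleton_ext_quotient_iff]
    exact solvesCompatible_iff_extends.1 (h n x hI')

theorem trivializesRelations_of_flat {n : ℕ} (x : Fin n → R) (M : Type u) [AddCommGroup M]
    [Module R M] [Module.Flat R M] : TrivializesRelations x M :=
  fun _ h => Module.Flat.isTrivialRelation_of_sum_smul_eq_zero h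

end Equational

/-! ### Equational form of semi-regular flatness -/

section Tor

variable {R : Type u} [CommRing R]

theorem one_tmul_eq_zero_iff {n : ℕ} {x : Fin n → R} {P : Type u} [AddCommGroup P] [Module R P]
    (p : P) :
    (1 : R ⧸ Ideal.span (Set.range x)) ⊗ₜ[R] p = 0 ↔ ∃ v : Fin n → P, p = ∑ i, x i • v i := by
  set I := Ideal.span (Set.range x)
  have h1 : (1 : R ⧸ I) ⊗ₜ[R] p = 0 ↔ p ∈ I • (⊤ : Submodule R P) := by
    rw [← (TensorProduct.quotTensorEquivQuotSMul P I).map_eq_zero_iff]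
    have := TensorProduct.quotTensorEquivQuotSMul_mk_tmul (M := P) I (1 : R) p
    rw [map_one] at this
    rw [this, one_smul, Submodule.Quotient.mk_eq_zero]
  rw [h1]
  clear h1
  constructor
  · intro h
    induction h using Submodule.smul_induction_on' with
    | smul r hr q hq =>
      obtain ⟨c, rfl⟩ := Ideal.mem_span_range_iff_exists_sum.1 hr
      exact ⟨fun i => c i • q, by simp [Finset.sum_smul, smul_smul, mul_comm]⟩
    | add a _ b _ ha hb =>
      obtain ⟨v, rfl⟩ := ha
      obtain ⟨w, rfl⟩ := hb
      exact ⟨v + w, by simp [Finset.sum_add_distrib]⟩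
  · rintro ⟨v, rfl⟩
    exact Submodule.sum_mem _ fun i _ =>
      Submodule.smul_mem_smul (Ideal.subset_span ⟨i, rfl⟩) trivial

theorem exists_one_tmul (I : Ideal R) {P : Type u} [AddCommGroup P] [Module R P]
    (t : TensorProduct R (R ⧸ I) P) : ∃ p : P, t = (1 : R ⧸ I) ⊗ₜ[R] p := by
  induction t with
  | zero => exact ⟨0, by simp⟩
  | add a b ha hb =>
    obtain ⟨p, rfl⟩ := ha
    obtain ⟨q, rfl⟩ := hb
    exact ⟨p + q, by rw [TensorProduct.tmul_add]⟩
  | tmul r p =>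
    obtain ⟨r, rfl⟩ := Ideal.Quotient.mk_surjective r
    refine ⟨r • p, ?_⟩
    rw [← TensorProduct.smul_tmul]
    congr 1
    rw [Algebra.smul_def, mul_one]; rfl

/-- Every tensor is 1 ⊗ p, and it vanishes iff p lies in IP, so exactness after tensoring is
exactness modulo I. -/
theorem exact_lTensor_quotient_iff {n : ℕ} {x : Fin n → R} {P₀ P₁ P₂ : Type u}
    [AddCommGroup P₀] [Module R P₀] [AddCommGroup P₁] [Module R P₁] [AddCommGroup P₂] [Module R P₂]
    (d₂ : P₂ →ₗ[R] P₁) (d₁ : P₁ →ₗ[R] P₀) :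
    (∀ t, d₁.lTensor (R ⧸ Ideal.span (Set.range x)) t = 0 →
      ∃ s, d₂.lTensor (R ⧸ Ideal.span (Set.range x)) s = t) ↔
    ∀ p (v : Fin n → P₀), d₁ p = ∑ i, x i • v i →
      ∃ (q : P₂) (w : Fin n → P₁), p = d₂ q + ∑ i, x i • w i := by
  constructor
  · intro h p v hv
    obtain ⟨s, hs⟩ := h (1 ⊗ₜ p) (by
      rw [LinearMap.lTensor_tmul]; exact (one_tmul_eq_zero_iff _).2 ⟨v, hv⟩)
    obtain ⟨q, rfl⟩ := exists_one_tmul _ s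
    rw [LinearMap.lTensor_tmul, eq_comm, ← sub_eq_zero, ← TensorProduct.tmul_sub,
      one_tmul_eq_zero_iff] at hs
    obtain ⟨w, hw⟩ := hs
    exact ⟨q, w, by rw [← hw]; abel⟩
  · intro h t ht
    obtain ⟨p, rfl⟩ := exists_one_tmul _ t
    rw [LinearMap.lTensor_tmul, one_tmul_eq_zero_iff] at ht
    obtain ⟨v, hv⟩ := ht
    obtain ⟨q, w, rfl⟩ := h p v hv
    refine ⟨1 ⊗ₜ q, ?_⟩
    rw [LinearMap.lTensor_tmul, eq_comm, ← sub_eq_zero, ← TensorProduct.tmul_sub,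
      one_tmul_eq_zero_iff]
    exact ⟨w, by abel⟩

/-- For `P₂ → P₁ → P₀ → M → 0` exact with `P₀` flat, the first homology of `R/(x) ⊗ P` detects
the triviality of relations in `M`. -/
theorem trivializesRelations_iff_of_resolution {n : ℕ} {x : Fin n → R} {P₀ P₁ P₂ M : Type u}
    [AddCommGroup P₀] [Module R P₀] [AddCommGroup P₁] [Module R P₁] [AddCommGroup P₂] [Module R P₂]
    [AddCommGroup M] [Module R M] [Module.Flat R P₀]
    (d₂ : P₂ →ₗ[R] P₁) (d₁ : P₁ →ₗ[R] P₀) (ε : P₀ →ₗ[R] M) (hε : Function.Surjective ε)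
    (h₀ : Function.Exact d₁ ε) (h₁ : Function.Exact d₂ d₁) :
    (∀ p (v : Fin n → P₀), d₁ p = ∑ i, x i • v i →
      ∃ (q : P₂) (w : Fin n → P₁), p = d₂ q + ∑ i, x i • w i) ↔ TrivializesRelations x M := by
  constructor
  · intro h v hv
    choose p hp using fun i => hε (v i)
    obtain ⟨z, hz⟩ := (h₀ (∑ i, x i • p i)).1 (by simp [hp, hv])
    obtain ⟨q, w, rfl⟩ := h z p hz
    -- Correcting the lifts by boundaries turns the relation in M into a relation in P₀, where
    -- flatness trivializes it.
    have h2 : ∑ i, x i • (p i - d₁ (w i)) = 0 := by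
      simp_rw [smul_sub, Finset.sum_sub_distrib]
      rw [← hz, map_add, h₁.apply_apply_eq_zero]
      simp
    obtain ⟨k, a, y, hy, ha⟩ := Module.Flat.isTrivialRelation_of_sum_smul_eq_zero h2
    refine ⟨k, a, fun j => ε (y j), fun i => ?_, ha⟩
    have := congrArg ε (hy i)
    rw [map_sub, h₀.apply_apply_eq_zero, sub_zero, hp] at this
    simpa using this
  · intro h p v hv
    obtain ⟨k, a, y, hy, ha⟩ := h (fun i => ε (v i)) (by
      simp_rw [← map_smul]
      rw [← map_sum, ← hv, h₀.apply_apply_eq_zero])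
    choose y' hy' using fun j => hε (y j)
    -- The trivialization lifted to P₀ misses `v i` only by a boundary. Subtracting these
    -- corrections, weighted by `x`, makes `p` a cycle.
    have h2 : ∀ i, ∃ z, d₁ z = v i - ∑ j, a i j • y' j := fun i =>
      (h₀ _).1 (by simp [hy', hy])
    choose z hz using h2
    have h3 : d₁ (p - ∑ i, x i • z i) = 0 := by
      rw [map_sub, hv, map_sum]
      simp_rw [map_smul, hz, smul_sub, Finset.sum_sub_distrib, Finset.smul_sum, smul_smul]
      rw [Finset.sum_comm (γ := Fin n)]
      simp_rw [← Finset.sum_smul, ha]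
      simp
    obtain ⟨q, hq⟩ := (h₁ _).1 h3
    exact ⟨q, z, by rw [hq]; abel⟩

open Limits in
theorem isZero_tor_one_iff {n : ℕ} (x : Fin n → R) (M : Type u) [AddCommGroup M] [Module R M] :
    IsZero (((Tor (ModuleCat.{u} R) 1).obj (ModuleCat.of R (R ⧸ Ideal.span (Set.range x)))).obj
      (ModuleCat.of R M)) ↔ TrivializesRelations x M := by
  let P := ProjectiveResolution.of (ModuleCat.of R M)
  let F := MonoidalCategory.tensorLeft (ModuleCat.of R (R ⧸ Ideal.span (Set.range x)))
  have e : ((Tor (ModuleCat.{u} R) 1).obj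
      (ModuleCat.of R (R ⧸ Ideal.span (Set.range x)))).obj (ModuleCat.of R M) ≅ _ :=
    P.isoLeftDerivedObj F 1
  have : Module.Projective R (P.complex.X 0) := ModuleCat.projective_of_module_projective _
  have hε : Function.Surjective (P.π.f 0).hom := (ModuleCat.epi_iff_surjective _).1 inferInstance
  have h0 : Function.Exact (P.complex.d 1 0).hom (P.π.f 0).hom :=
    (ShortComplex.ShortExact.moduleCat_exact_iff_function_exact _).1 P.exact₀
  have h1 : Function.Exact (P.complex.d 2 1).hom (P.complex.d 1 0).hom :=
    (ShortComplex.ShortExact.moduleCat_exact_iff_function_exact _).1 (P.exact_succ 0)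
  have key := (exact_lTensor_quotient_iff (x := x) (P.complex.d 2 1).hom
    (P.complex.d 1 0).hom).trans (trivializesRelations_iff_of_resolution (M := M)
      (P.complex.d 2 1).hom (P.complex.d 1 0).hom (P.π.f 0).hom hε h0 h1)
  rw [e.isZero_iff]
  change IsZero (HomologicalComplex.homology _ 1) ↔ _
  rw [← HomologicalComplex.exactAt_iff_isZero_homology,
    HomologicalComplex.exactAt_iff' _ 2 1 0 (by simp) (by simp),
    ShortComplex.moduleCat_exact_iff]
  exact key

theorem isSemiregularFlat_iff {M : Type u} [AddCommGroup M] [Module R M] :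
    IsSemiregularFlat R M ↔ ∀ (n : ℕ) (x : Fin n → R),
      (Ideal.span (Set.range x)).IsSemiregular → TrivializesRelations x M := by
  constructor
  · intro h n x hx
    rw [← isZero_tor_one_iff]
    exact h _ ⟨(Set.finite_range x).toFinset, by simp⟩ hx
  · intro h I hI hI'
    obtain ⟨n, x, rfl⟩ := Submodule.fg_iff_exists_fin_generating_family.1 hI
    exact (isZero_tor_one_iff x M).2 (h n x hI')

end Tor

/-! ### Relation modules, coherence and products -/

section Coherent

variable {R : Type u} [CommRing R]

/-- The module of linear relations satisfied by the family `x`. -/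
def relationModule {n : ℕ} (x : Fin n → R) : Submodule R (Fin n → R) :=
  LinearMap.ker (Fintype.linearCombination R x)

theorem mem_relationModule {n : ℕ} {x c : Fin n → R} :
    c ∈ relationModule x ↔ ∑ i, c i * x i = 0 := by
  simp [relationModule, Fintype.linearCombination_apply]

theorem finitePresentation_span_range_iff {n : ℕ} (x : Fin n → R) :
    Module.FinitePresentation R (Ideal.span (Set.range x)) ↔ (relationModule x).FG := by
  let q := Fintype.linearCombination R x
  have hr : LinearMap.range q = Ideal.span (Set.range x) := Fintype.range_linearCombination R x
  have hk : LinearMap.ker q.rangeRestrict = relationModule x := LinearMap.ker_rangeRestrict q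
  rw [← hr, ← hk]
  constructor
  · intro h
    exact Module.FinitePresentation.fg_ker _ q.surjective_rangeRestrict
  · intro h
    exact Module.finitePresentation_of_surjective _ q.surjective_rangeRestrict h

theorem isSemiregularCoherent_iff :
    IsSemiregularCoherent R ↔ ∀ (n : ℕ) (x : Fin n → R),
      (Ideal.span (Set.range x)).IsSemiregular → (relationModule x).FG := by
  constructor
  · intro h n x hx
    rw [← finitePresentation_span_range_iff]
    exact h _ ⟨(Set.finite_range x).toFinset, by simp⟩ hx
  · intro h I hI hI'
    obtain ⟨n, x, rfl⟩ := Submodule.fg_iff_exists_fin_generating_family.1 hI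
    exact (finitePresentation_span_range_iff x).2 (h n x hI')

theorem mem_relationModule_iff_of_span_eq {n m : ℕ} {x : Fin n → R} {A : Fin m → Fin n → R}
    (hA : Submodule.span R (Set.range A) = relationModule x) {c : Fin n → R} :
    ∑ i, c i * x i = 0 ↔ ∃ b : Fin m → R, ∀ i, c i = ∑ l, b l * A l i := by
  rw [← mem_relationModule, ← hA, Submodule.mem_span_range_iff_exists_fun]
  refine exists_congr fun b => ?_
  rw [eq_comm, funext_iff]
  simp

theorem sum_row_mul_eq_zero {n m : ℕ} {x : Fin n → R} {A : Fin m → Fin n → R}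
    (hA : Submodule.span R (Set.range A) = relationModule x) (l : Fin m) :
    ∑ i, A l i * x i = 0 :=
  mem_relationModule.1 (hA ▸ Submodule.subset_span ⟨l, rfl⟩)

/-- If the relation module of `x` is generated by the rows of `A`, trivial relations are
trivialized by these rows. -/
theorem isTrivialRelation_iff_of_span_eq {n m : ℕ} {x : Fin n → R} {A : Fin m → Fin n → R}
    (hA : Submodule.span R (Set.range A) = relationModule x)
    {M : Type u} [AddCommGroup M] [Module R M] {v : Fin n → M} :
    Module.IsTrivialRelation x v ↔ ∃ w : Fin m → M, ∀ i, v i = ∑ l, A l i • w l := by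
  constructor
  · rintro ⟨k, a, y, hy, ha⟩
    have : ∀ j, ∃ b : Fin m → R, ∀ i, a i j = ∑ l, b l * A l i := fun j =>
      (mem_relationModule_iff_of_span_eq hA).1 (by simpa [mul_comm] using ha j)
    choose b hb using this
    refine ⟨fun l => ∑ j, b j l • y j, fun i => ?_⟩
    rw [hy]
    simp_rw [hb, Finset.sum_smul, Finset.smul_sum, smul_smul]
    rw [Finset.sum_comm]
    simp_rw [mul_comm]
  · rintro ⟨w, hw⟩
    exact ⟨m, fun i l => A l i, w, hw, fun l => by
      simpa [mul_comm] using sum_row_mul_eq_zero hA l⟩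

/-- The generating rows `A` do not depend on the factor, so trivializations chosen in each factor
assemble into one. -/
theorem IsSemiregularCoherent.isSemiregularFlat_pi (h : IsSemiregularCoherent R) {ι : Type u}
    (F : ι → Type u) [∀ i, AddCommGroup (F i)] [∀ i, Module R (F i)]
    (hF : ∀ i, IsSemiregularFlat R (F i)) : IsSemiregularFlat R (∀ i, F i) := by
  rw [isSemiregularFlat_iff]
  intro n x hx v hv
  obtain ⟨m, A, hA⟩ := Submodule.fg_iff_exists_fin_generating_family.1
    (isSemiregularCoherent_iff.1 h n x hx)
  rw [isTrivialRelation_iff_of_span_eq hA]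
  have : ∀ i, ∃ w : Fin m → F i, ∀ k, v k i = ∑ l, A l k • w l := fun i => by
    rw [← isTrivialRelation_iff_of_span_eq hA]
    exact isSemiregularFlat_iff.1 (hF i) n x hx _ (by simpa using congrFun hv i)
  choose w hw using this
  exact ⟨fun l i => w i l, fun k => funext fun i => by simp [hw i k]⟩

/-- Index the product by the relation module itself and use the tautological relation. The finitely
many columns of a trivialization generate all relations, with the coordinates of `y` as
coefficients. -/
theorem isSemiregularCoherent_of_pi_flat (h : ∀ ι : Type u, IsSemiregularFlat R (ι → R)) :
    IsSemiregularCoherent R := by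
  rw [isSemiregularCoherent_iff]
  intro n x hx
  obtain ⟨k, a, y, hy, ha⟩ := isSemiregularFlat_iff.1 (h (relationModule x)) n x hx
    (fun i c => c.1 i) (by
      ext c
      simpa [mul_comm] using mem_relationModule.1 c.2)
  rw [Submodule.fg_iff_exists_fin_generating_family]
  refine ⟨k, fun j i => a i j, le_antisymm (Submodule.span_le.2 ?_) fun c hc => ?_⟩
  · rintro _ ⟨j, rfl⟩
    exact mem_relationModule.2 (by simpa [mul_comm] using ha j)
  · rw [Submodule.mem_span_range_iff_exists_fun]
    refine ⟨fun j => y j ⟨c, hc⟩, ?_⟩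
    ext i
    have := congrFun (hy i) ⟨c, hc⟩
    simp only [Finset.sum_apply, Pi.smul_apply, smul_eq_mul] at this ⊢
    rw [this]
    simp_rw [mul_comm]

end Coherent

/-! ### Duality into injective modules -/

section Duality

variable {R : Type u} [CommRing R]

theorem isSemiregularCoflat_of_injective {E : Type u} [AddCommGroup E] [Module R E]
    (hE : Module.Injective R E) : IsSemiregularCoflat R E := by
  rw [isSemiregularCoflat_iff]
  intro n x _
  rw [solvesCompatible_iff_extends]
  intro f
  obtain ⟨g, hg⟩ := hE.out (Ideal.span (Set.range x)).subtype (Submodule.injective_subtype _) f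
  exact ⟨g 1, fun a => by rw [← hg, ← map_smul]; simp⟩

/-- The solution must send ∑ xᵢvᵢ to ∑ yᵢ(vᵢ). This is well defined because a relation of `x` in M
is trivial and compatible families annihilate trivial relations. -/
theorem IsSemiregularFlat.isSemiregularCoflat_hom {M E : Type u} [AddCommGroup M] [Module R M]
    [AddCommGroup E] [Module R E] (hM : IsSemiregularFlat R M) (hE : Module.Injective R E) :
    IsSemiregularCoflat R (M →ₗ[R] E) := by
  rw [isSemiregularCoflat_iff]
  intro n x hx y hy
  let q : (Fin n → M) →ₗ[R] M := ∑ i, x i • LinearMap.proj i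
  let φ : (Fin n → M) →ₗ[R] E := ∑ i, (y i).comp (LinearMap.proj i)
  obtain ⟨ψ, hψ⟩ := hE.exists_factor q φ (fun v hv => by
    obtain ⟨k, a, w, hw, ha⟩ := isSemiregularFlat_iff.1 hM n x hx v (by simpa [q] using hv)
    have : ∀ j, ∑ i, a i j • y i = 0 := fun j => hy _ (by simpa [mul_comm] using ha j)
    simp only [φ, LinearMap.sum_apply, LinearMap.comp_apply, LinearMap.proj_apply, hw, map_sum,
      map_smul]
    rw [Finset.sum_comm]
    refine Finset.sum_eq_zero fun j _ => ?_
    simpa using congrArg (fun g => g (w j)) (this j))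
  refine ⟨ψ, fun i => LinearMap.ext fun m => ?_⟩
  have := hψ (Pi.single i m)
  simp only [q, φ, LinearMap.sum_apply, LinearMap.comp_apply, LinearMap.proj_apply,
    LinearMap.smul_apply] at this
  rw [Finset.sum_eq_single i (by intro j _ hj; simp [hj]) (by simp),
    Finset.sum_eq_single i (by intro j _ hj; simp [hj]) (by simp)] at this
  simpa using this.symm

/-- Coflatness makes N → N^n → N^m, given by `x` and then the rows `A`, exact in the middle. A
relation in Hom(N, E) is a map N^n → E killing the image of `x`, so by injectivity it factors
through `A`. -/
theorem IsSemiregularCoherent.isSemiregularFlat_hom (h : IsSemiregularCoherent R) {N E : Type u}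
    [AddCommGroup N] [Module R N] [AddCommGroup E] [Module R E] (hN : IsSemiregularCoflat R N)
    (hE : Module.Injective R E) : IsSemiregularFlat R (N →ₗ[R] E) := by
  rw [isSemiregularFlat_iff]
  intro n x hx v hv
  obtain ⟨m, A, hA⟩ := Submodule.fg_iff_exists_fin_generating_family.1
    (isSemiregularCoherent_iff.1 h n x hx)
  rw [isTrivialRelation_iff_of_span_eq hA]
  let q : (Fin n → N) →ₗ[R] (Fin m → N) :=
    LinearMap.pi fun l => ∑ i, A l i • LinearMap.proj i
  let φ : (Fin n → N) →ₗ[R] E := ∑ i, (v i).comp (LinearMap.proj i)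
  obtain ⟨ψ, hψ⟩ := hE.exists_factor q φ (fun y hy => by
    obtain ⟨z, hz⟩ := isSemiregularCoflat_iff.1 hN n x hx y (fun c hc => by
      obtain ⟨b, hb⟩ := (mem_relationModule_iff_of_span_eq hA).1 hc
      simp_rw [hb, Finset.sum_smul, ← smul_smul]
      rw [Finset.sum_comm]
      refine Finset.sum_eq_zero fun l _ => ?_
      rw [← Finset.smul_sum]
      have : ∑ i, A l i • y i = 0 := by simpa [q] using congrFun hy l
      rw [this, smul_zero])
    simp only [φ, LinearMap.sum_apply, LinearMap.comp_apply, LinearMap.proj_apply, hz, map_smul]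
    simpa using congrArg (fun g => g z) hv)
  refine ⟨fun l => ψ.comp (LinearMap.single R (fun _ => N) l), fun i => LinearMap.ext fun y => ?_⟩
  have h1 := hψ (Pi.single i y)
  have h2 : q (Pi.single i y) = ∑ l, A l i • Pi.single l y := by
    ext l
    simp only [q, LinearMap.pi_apply, LinearMap.sum_apply, LinearMap.smul_apply,
      LinearMap.proj_apply, Finset.sum_apply, Pi.smul_apply]
    rw [Finset.sum_eq_single i (by intro j _ hj; simp [hj]) (by simp),
      Finset.sum_eq_single l (by intro j _ hj; simp [hj.symm]) (by simp)]
    simp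
  have h3 : φ (Pi.single i y) = v i y := by
    simp only [φ, LinearMap.sum_apply, LinearMap.comp_apply, LinearMap.proj_apply]
    rw [Finset.sum_eq_single i (by intro j _ hj; simp [hj]) (by simp)]
    simp
  rw [← h3, ← h1, h2]
  simp

theorem CharacterModule.exists_linearMap_apply_ne_zero {M : Type u} [AddCommGroup M] [Module R M]
    {m : M} (hm : m ≠ 0) : ∃ h : M →ₗ[R] CharacterModule R, h m ≠ 0 := by
  obtain ⟨c, hc⟩ := CharacterModule.exists_character_apply_ne_zero_of_ne_zero hm
  refine ⟨CharacterModule.curry (CharacterModule.dual (TensorProduct.rid R M).toLinearMap c),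
    fun h => hc ?_⟩
  have : CharacterModule.curry (CharacterModule.dual (TensorProduct.rid R M).toLinearMap c) m 1
    = c ((1 : R) • m) := rfl
  rw [h, one_smul] at this
  exact this.symm

theorem injective_characterModule_self : Module.Injective R (CharacterModule R) :=
  Module.Flat.iff_characterModule_injective.1 inferInstance

theorem isInjectiveCogenerator_characterModule :
    IsInjectiveCogenerator R (CharacterModule R) := by
  refine ⟨injective_characterModule_self, (Preadditive.isCoseparator_iff _).2 fun X Y f hf => ?_⟩
  ext x
  by_contra hx
  obtain ⟨h, hh⟩ := CharacterModule.exists_linearMap_apply_ne_zero (R := R) hx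
  exact hh (congrArg (fun k => k.hom x) (hf (ModuleCat.ofHom h)))

/-- `R → End (CharacterModule R)` is pure: solvability of a linear system descends. -/
theorem exists_eq_sum_mul_of_characterModule {n k : ℕ} {a : Fin n → Fin k → R} {r : Fin n → R}
    (w : Fin k → (CharacterModule R →ₗ[R] CharacterModule R))
    (hw : ∀ i e, r i • e = ∑ j, a i j • w j e) : ∃ s : Fin k → R, ∀ i, r i = ∑ j, a i j * s j := by
  let S := Submodule.span R (Set.range fun j i => a i j)
  by_cases hr : r ∈ S
  · obtain ⟨s, hs⟩ := (Submodule.mem_span_range_iff_exists_fun R).1 hr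
    refine ⟨s, fun i => ?_⟩
    rw [← hs]
    simp [mul_comm]
  exfalso
  -- If `r` is not a combination of the columns of `a`, a map to the character module kills the
  -- columns but not `r`. Its values on the basis vectors are the elements at which `hw` is tested.
  obtain ⟨h, hh⟩ := CharacterModule.exists_linearMap_apply_ne_zero (R := R) (m := S.mkQ r)
    (by simpa using hr)
  apply hh
  let e : Fin n → CharacterModule R := fun i => h (S.mkQ (Pi.single i 1))
  have key : ∀ t : Fin n → R, h (S.mkQ t) = ∑ i, t i • e i := fun t => by
    conv_lhs => rw [pi_eq_sum_univ' t]
    simp only [map_sum, map_smul, e]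
  rw [key]
  simp_rw [hw, ← map_smul]
  rw [Finset.sum_comm]
  refine Finset.sum_eq_zero fun j _ => ?_
  rw [← map_sum, ← key]
  have : S.mkQ (fun i => a i j) = 0 := by
    rw [Submodule.mkQ_apply, Submodule.Quotient.mk_eq_zero]
    exact Submodule.subset_span ⟨j, rfl⟩
  rw [this, map_zero, map_zero]

/-- The sum ∑ᵢ r k i • e i only makes sense for finitely supported `e`. The `v k` are obtained by
prescribing these values together with zero on all tuples (x k • e)ₖ. The two prescriptions agree
where they overlap because `r` is a relation in every coordinate. -/
theorem exists_hom_extending_of_sum_eq_zero {E : Type u} [AddCommGroup E] [Module R E]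
    (hE : Module.Injective R E) {n : ℕ} {x : Fin n → R} {ι : Type u} [DecidableEq ι]
    {r : Fin n → ι → R} (hr : ∑ k, x k • r k = 0) :
    ∃ v : Fin n → ((ι → E) →ₗ[R] E), ∑ k, x k • v k = 0 ∧
      ∀ k i e, v k (Pi.single i e) = r k i • e := by
  have hr' : ∀ i, ∑ k, x k * r k i = 0 := fun i => by simpa using congrFun hr i
  let q : ((Fin n → ι →₀ E) × (ι → E)) →ₗ[R] (Fin n → ι → E) := LinearMap.coprod
    (LinearMap.pi fun k => (Finsupp.lcoeFun (R := R)).comp (LinearMap.proj k))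
    (LinearMap.pi fun k => x k • LinearMap.id)
  let φ : ((Fin n → ι →₀ E) × (ι → E)) →ₗ[R] E := LinearMap.coprod
    (∑ k, (Finsupp.lsum R fun i => r k i • LinearMap.id).comp (LinearMap.proj k)) 0
  have hq : ∀ f e k i, q (f, e) k i = f k i + x k • e i := fun f e k i => rfl
  have hφ : ∀ f e, φ (f, e) = ∑ k, (f k).sum fun i e => r k i • e := fun f e => by
    simp only [φ, LinearMap.coprod_apply, LinearMap.zero_apply, add_zero, LinearMap.sum_apply]
    rfl
  obtain ⟨ψ, hψ⟩ := hE.exists_factor q φ (by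
    rintro ⟨f, e⟩ h
    have hf : ∀ k i, f k i = - (x k • e i) := fun k i => by
      have := congrFun (congrFun h k) i
      rw [hq] at this
      exact eq_neg_of_add_eq_zero_left this
    let s : Finset ι := Finset.univ.biUnion fun k => (f k).support
    rw [hφ, Finset.sum_congr rfl fun k _ => Finsupp.sum_of_support_subset (s := s) (f k)
      (Finset.subset_biUnion_of_mem (fun k => (f k).support) (Finset.mem_univ k)) _ (by simp),
      Finset.sum_comm]
    refine Finset.sum_eq_zero fun i _ => ?_
    simp_rw [hf, smul_neg, smul_smul]
    rw [Finset.sum_neg_distrib, ← Finset.sum_smul]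
    simp_rw [mul_comm (r _ _), hr' i]
    simp)
  refine ⟨fun k => ψ.comp (LinearMap.single R (fun _ => ι → E) k), ?_, fun k i e => ?_⟩
  · ext e
    have h1 := hψ (0, e)
    have h2 : q (0, e) = ∑ k, x k • Pi.single k e := by
      ext k i
      rw [hq, Finset.sum_apply, Finset.sum_eq_single k (by intro j _ hj; simp [hj.symm]) (by simp)]
      simp
    rw [h2, hφ] at h1
    simpa using h1
  · have h1 := hψ (Pi.single k (Finsupp.single i e), 0)
    have h2 : q (Pi.single k (Finsupp.single i e), 0) = Pi.single k (Pi.single i e) := by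
      ext k' i'
      rw [hq]
      by_cases h : k' = k
      · subst h
        simp [Finsupp.single_eq_pi_single]
      · simp [h]
    rw [h2, hφ, Finset.sum_eq_single k (by intro j _ hj; simp [hj]) (by simp)] at h1
    simpa using h1

/-- The bidual of the free module on ι is Hom(E^ι, E). A relation in R^ι is extended to it and
trivialized there. Restriction to each coordinate then gives systems over R with the same
coefficients `a`, which are solvable in R by purity of R → End E. -/
theorem isSemiregularFlat_pi_of_bidual
    (h : ∀ M : Type u, [AddCommGroup M] → [Module R M] → IsSemiregularFlat R M →
      IsSemiregularFlat R ((M →ₗ[R] CharacterModule R) →ₗ[R] CharacterModule R)) (ι : Type u) :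
    IsSemiregularFlat R (ι → R) := by
  classical
  let E := CharacterModule R
  let W := ι →₀ R
  have hW : IsSemiregularFlat R W :=
    isSemiregularFlat_iff.2 fun n x _ => trivializesRelations_of_flat x W
  rw [isSemiregularFlat_iff]
  intro n x hx r hr
  obtain ⟨v, hv, hv'⟩ := exists_hom_extending_of_sum_eq_zero
    (injective_characterModule_self (R := R)) hr
  let T : (W →ₗ[R] E) →ₗ[R] (ι → E) :=
    LinearMap.pi fun i => LinearMap.applyₗ (Finsupp.single i 1)
  let S : ι → E →ₗ[R] (W →ₗ[R] E) := fun i =>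
    LinearMap.flip ((LinearMap.lsmul R E).comp (Finsupp.lapply i))
  have hTS : ∀ i e, T (S i e) = Pi.single i e := fun i e => by
    ext j : 1
    have : T (S i e) j = (Finsupp.single j 1 : W) i • e := rfl
    rw [this]
    by_cases hj : j = i
    · subst hj; simp
    · simp [hj]
  obtain ⟨k, a, w, hw, ha⟩ := isSemiregularFlat_iff.1 (h W hW) n x hx
    (fun k => (v k).comp T) (by
      ext g : 1
      simpa using congrArg (fun f => f (T g)) hv)
  have : ∀ i, ∃ s : Fin k → R, ∀ l, r l i = ∑ j, a l j * s j := fun i =>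
    exists_eq_sum_mul_of_characterModule (fun j => (w j).comp (S i)) fun l e => by
      rw [← hv' l i e, ← hTS]
      refine (congrArg (fun f => f (S i e)) (hw l)).trans ?_
      simp only [LinearMap.sum_apply, LinearMap.smul_apply, LinearMap.comp_apply]
  choose s hs using this
  exact ⟨k, a, fun j i => s i j, fun l => funext fun i => by simp [hs], ha⟩

end Duality

/-! ### Closure properties of coflat modules -/

section CoflatClosure

variable {R : Type u} [CommRing R]

theorem IsSemiregularCoflat.of_retract {M N : Type u} [AddCommGroup M] [Module R M]
    [AddCommGroup N] [Module R N] (hN : IsSemiregularCoflat R N) (i : M →ₗ[R] N) (p : N →ₗ[R] M)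
    (hpi : ∀ m, p (i m) = m) : IsSemiregularCoflat R M := by
  rw [isSemiregularCoflat_iff] at hN ⊢
  intro n x hx y hy
  obtain ⟨z, hz⟩ := hN n x hx (fun k => i (y k)) (fun c hc => by
    simp_rw [← map_smul, ← map_sum, hy c hc, map_zero])
  exact ⟨p z, fun k => by rw [← map_smul, ← hz, hpi]⟩

theorem compatible_iff_of_span_eq {n m : ℕ} {x : Fin n → R} {A : Fin m → Fin n → R}
    (hA : Submodule.span R (Set.range A) = relationModule x)
    {M : Type u} [AddCommGroup M] [Module R M] {y : Fin n → M} :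
    (∀ c : Fin n → R, ∑ i, c i * x i = 0 → ∑ i, c i • y i = 0) ↔
      ∀ l, ∑ i, A l i • y i = 0 := by
  refine ⟨fun h l => h _ (sum_row_mul_eq_zero hA l), fun h c hc => ?_⟩
  obtain ⟨b, hb⟩ := (mem_relationModule_iff_of_span_eq hA).1 hc
  simp_rw [hb, Finset.sum_smul, ← smul_smul]
  rw [Finset.sum_comm]
  refine Finset.sum_eq_zero fun l _ => ?_
  rw [← Finset.smul_sum, h, smul_zero]

/-- Linear systems with right-hand side in `K` that are solvable in `N` are solvable in `K`. -/
def Submodule.IsEquationallyPure {N : Type u} [AddCommGroup N] [Module R N]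
    (K : Submodule R N) : Prop :=
  ∀ (n m : ℕ) (A : Fin m → Fin n → R) (u : Fin n → N), (∀ j, ∑ i, A j i • u i ∈ K) →
    ∃ v : Fin n → N, (∀ i, v i ∈ K) ∧ ∀ j, ∑ i, A j i • v i = ∑ i, A j i • u i

/-- Purity is tested on X = R^m modulo the columns of `A`. The right-hand side defines a tensor in X
⊗ K that dies in X ⊗ N, and the equational criterion for its vanishing yields a solution in K. -/
theorem Submodule.IsPureSubmodule.isEquationallyPure {N : Type u} [AddCommGroup N] [Module R N]
    {K : Submodule R N} (hK : K.IsPureSubmodule) : K.IsEquationallyPure := by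
  intro n m A u hu
  let S := Submodule.span R (Set.range fun (i : Fin n) (j : Fin m) => A j i)
  let e : Fin m → (Fin m → R) ⧸ S := fun j => S.mkQ (Pi.single j 1)
  have he : ∀ t : Fin m → R, S.mkQ t = ∑ j, t j • e j := fun t => by
    conv_lhs => rw [pi_eq_sum_univ' t]
    simp only [map_sum, map_smul, e]
  have hspan : Submodule.span R (Set.range e) = ⊤ := by
    rw [eq_top_iff]
    rintro q -
    obtain ⟨t, rfl⟩ := S.mkQ_surjective q
    rw [he]
    exact Submodule.sum_mem _ fun j _ => Submodule.smul_mem _ _ (Submodule.subset_span ⟨j, rfl⟩)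
  have hzero : ∑ j, e j ⊗ₜ[R] (⟨∑ i, A j i • u i, hu j⟩ : K) = 0 := by
    apply hK
    rw [map_sum, map_zero]
    simp_rw [LinearMap.lTensor_tmul, Submodule.subtype_apply, TensorProduct.tmul_sum,
      ← TensorProduct.smul_tmul]
    rw [Finset.sum_comm]
    refine Finset.sum_eq_zero fun i _ => ?_
    rw [← TensorProduct.sum_tmul, ← he fun j => A j i]
    have : S.mkQ (fun j => A j i) = 0 := by
      rw [Submodule.mkQ_apply, Submodule.Quotient.mk_eq_zero]
      exact Submodule.subset_span ⟨i, rfl⟩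
    rw [this, TensorProduct.zero_tmul]
  obtain ⟨κ, a, y, hy, ha⟩ :=
    TensorProduct.vanishesTrivially_of_sum_tmul_eq_zero R hspan hzero
  have hb : ∀ l, ∃ b : Fin n → R, ∀ j, a j l = ∑ i, b i * A j i := fun l => by
    have : S.mkQ (fun j => a j l) = 0 := by rw [he]; exact ha l
    rw [Submodule.mkQ_apply, Submodule.Quotient.mk_eq_zero] at this
    obtain ⟨b, hb⟩ := (Submodule.mem_span_range_iff_exists_fun R).1 this
    exact ⟨b, fun j => by simpa using (congrFun hb j).symm⟩
  choose b hb using hb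
  refine ⟨fun i => ((∑ l, b l i • y l : K) : N), fun i => SetLike.coe_mem _, fun j => ?_⟩
  have h1 : (∑ i, A j i • ∑ l, b l i • y l : K) = ⟨∑ i, A j i • u i, hu j⟩ := by
    refine Eq.trans ?_ (hy j).symm
    simp_rw [hb, Finset.sum_smul, Finset.smul_sum, smul_smul]
    rw [Finset.sum_comm]
    simp_rw [mul_comm]
  simpa using congrArg Subtype.val h1

/-- Lifts of a compatible family satisfy the finitely many equations `A` only modulo K. Purity
corrects the lifts by elements of K so that the equations hold in N. -/
theorem IsSemiregularCoherent.isSemiregularCoflat_quotient (h : IsSemiregularCoherent R)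
    {N : Type u} [AddCommGroup N] [Module R N] {K : Submodule R N}
    (hN : IsSemiregularCoflat R N) (hK : K.IsEquationallyPure) :
    IsSemiregularCoflat R (N ⧸ K) := by
  rw [isSemiregularCoflat_iff] at hN ⊢
  intro n x hx y hy
  obtain ⟨m, A, hA⟩ := Submodule.fg_iff_exists_fin_generating_family.1
    (isSemiregularCoherent_iff.1 h n x hx)
  choose u hu using fun i => K.mkQ_surjective (y i)
  have h1 : ∀ j, ∑ i, A j i • u i ∈ K := fun j => by
    rw [← Submodule.Quotient.mk_eq_zero, ← Submodule.mkQ_apply, map_sum]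
    simp_rw [map_smul, hu]
    exact (compatible_iff_of_span_eq hA).1 hy j
  obtain ⟨v, hv, hv'⟩ := hK n m A u h1
  obtain ⟨z, hz⟩ := hN n x hx (fun i => u i - v i) ((compatible_iff_of_span_eq hA).2 fun l => by
    simp_rw [smul_sub, Finset.sum_sub_distrib, hv', sub_self])
  refine ⟨K.mkQ z, fun i => ?_⟩
  rw [← map_smul, ← hz, map_sub, hu, K.mkQ_apply (v i), (Submodule.Quotient.mk_eq_zero K).2 (hv i),
    sub_zero]

/-- Compatibility is a finite set of equations on finitely many elements, so it already holds at
some stage. -/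
theorem IsSemiregularCoherent.isSemiregularCoflat_directLimit (h : IsSemiregularCoherent R)
    {ι : Type u} [DecidableEq ι] [Preorder ι] [IsDirectedOrder ι] [Nonempty ι]
    (G : ι → Type u) [∀ i, AddCommGroup (G i)] [∀ i, Module R (G i)]
    (f : ∀ i j, i ≤ j → G i →ₗ[R] G j) [DirectedSystem G (fun i j h => f i j h)]
    (hG : ∀ i, IsSemiregularCoflat R (G i)) :
    IsSemiregularCoflat R (Module.DirectLimit G f) := by
  rw [isSemiregularCoflat_iff]
  intro n x hx y hy
  obtain ⟨m, A, hA⟩ := Submodule.fg_iff_exists_fin_generating_family.1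
    (isSemiregularCoherent_iff.1 h n x hx)
  rw [compatible_iff_of_span_eq hA] at hy
  choose i g hg using fun k => Module.DirectLimit.exists_of (y k)
  obtain ⟨j, hj⟩ := Finite.exists_le i
  have hg' : ∀ k, Module.DirectLimit.of R ι G f j (f (i k) j (hj k) (g k)) = y k := fun k => by
    rw [Module.DirectLimit.of_f, hg]
  have h1 : ∀ l, ∃ (k : ι) (hk : j ≤ k),
      f j k hk (∑ k, A l k • f (i k) j (hj k) (g k)) = 0 := fun l =>
    Module.DirectLimit.of.zero_exact (by simp_rw [map_sum, map_smul, hg', hy l])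
  choose k hk hk0 using h1
  obtain ⟨p, hp⟩ := Finite.exists_le k
  obtain ⟨q, hq, hpq⟩ := directed_of (· ≤ ·) j p
  obtain ⟨z, hz⟩ := isSemiregularCoflat_iff.1 (hG q) n x hx
    (fun k => f j q hq (f (i k) j (hj k) (g k))) ((compatible_iff_of_span_eq hA).2 fun l => by
      have := congrArg (f (k l) q ((hp l).trans hpq)) (hk0 l)
      rw [DirectedSystem.map_map (f := fun i j h => f i j h), map_zero] at this
      simp_rw [← map_smul]
      rw [← map_sum]
      simpa using this)
  refine ⟨Module.DirectLimit.of R ι G f q z, fun k => ?_⟩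
  rw [← map_smul, ← hz, Module.DirectLimit.of_f, hg']

theorem isSemiregularCoflat_pi {J : Type u} {G : J → Type u} [∀ j, AddCommGroup (G j)]
    [∀ j, Module R (G j)] (hG : ∀ j, IsSemiregularCoflat R (G j)) :
    IsSemiregularCoflat R (∀ j, G j) := by
  rw [isSemiregularCoflat_iff]
  intro n x hx y hy
  choose z hz using fun j => isSemiregularCoflat_iff.1 (hG j) n x hx (fun k => y k j)
    (fun c hc => by simpa using congrFun (hy c hc) j)
  exact ⟨z, fun k => funext fun j => hz j k⟩

end CoflatClosure

/-! ### Coherence from reduced products -/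

section ReducedProducts

variable (R : Type u) [CommRing R]

section

variable {J : Type u} [LinearOrder J] (G : J → Type u) [∀ j, AddCommGroup (G j)]
  [∀ j, Module R (G j)]

/-- The families vanishing at all indices from `j` on. -/
def zeroFrom (j : J) : Submodule R (∀ j, G j) where
  carrier := {x | ∀ i, j ≤ i → x i = 0}
  zero_mem' := fun _ _ => rfl
  add_mem' := fun ha hb i hi => by simp [ha i hi, hb i hi]
  smul_mem' := fun r a ha i hi => by simp [ha i hi]

theorem zeroFrom_mono : Monotone (zeroFrom R G) :=
  fun _ _ h _ hx i hi => hx i (h.trans hi)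

/-- The families vanishing eventually. -/
def eventuallyZero : Submodule R (∀ j, G j) := ⨆ j, zeroFrom R G j

variable {R G} in
theorem mem_eventuallyZero [Nonempty J] {x : ∀ j, G j} :
    x ∈ eventuallyZero R G ↔ ∃ j, ∀ i, j ≤ i → x i = 0 :=
  Submodule.mem_iSup_of_directed _ (zeroFrom_mono R G).directed_le

/-- Truncation of a family at `j`. -/
def truncate [Nonempty J] (j : J) : (∀ j, G j) →ₗ[R] eventuallyZero R G :=
  LinearMap.codRestrict _
    (LinearMap.pi fun i => if i < j then LinearMap.proj i else 0) fun x =>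
      mem_eventuallyZero.2 ⟨j, fun i hi => by simp [not_lt.2 hi]⟩

variable {R G} in
theorem truncate_eq [Nonempty J] {j : J} (x : eventuallyZero R G) (hx : ∀ i, j ≤ i → x.1 i = 0) :
    truncate R G j x.1 = x := by
  ext i
  by_cases hi : i < j
  · simp [truncate, hi]
  · simp [truncate, hi, hx i (not_lt.1 hi)]

/-- A tensor involves finitely many eventually vanishing families, and truncation at a late index is
a left inverse of the inclusion on all of them. -/
theorem isPureSubmodule_eventuallyZero [Nonempty J] : (eventuallyZero R G).IsPureSubmodule := by
  intro X _ _
  have key : ∀ t : TensorProduct R X (eventuallyZero R G), ∃ j₀ : J, ∀ j, j₀ ≤ j →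
      (truncate R G j).lTensor X ((eventuallyZero R G).subtype.lTensor X t) = t := by
    intro t
    induction t with
    | zero => exact ⟨Classical.arbitrary J, by simp⟩
    | add a b ha hb =>
      obtain ⟨i, hi⟩ := ha
      obtain ⟨j, hj⟩ := hb
      refine ⟨max i j, fun k hk => ?_⟩
      rw [map_add, map_add, hi k (le_of_max_le_left hk), hj k (le_of_max_le_right hk)]
    | tmul a x =>
      obtain ⟨j, hj⟩ := mem_eventuallyZero.1 x.2
      refine ⟨j, fun k hk => ?_⟩
      rw [LinearMap.lTensor_tmul, LinearMap.lTensor_tmul, Submodule.subtype_apply,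
        truncate_eq x fun i hi => hj i (hk.trans hi)]
  rw [injective_iff_map_eq_zero]
  intro t ht
  obtain ⟨j, hj⟩ := key t
  rw [← hj j le_rfl, ht, map_zero]

variable {G} in
-- This quotient is the product of the `G i` with j ≤ i.
theorem isSemiregularCoflat_pi_quotient_zeroFrom (hG : ∀ j, IsSemiregularCoflat R (G j)) (j : J) :
    IsSemiregularCoflat R ((∀ j, G j) ⧸ zeroFrom R G j) := by
  classical
  rw [isSemiregularCoflat_iff]
  intro n x hx y hy
  choose v hv using fun k => (zeroFrom R G j).mkQ_surjective (y k)
  have : ∀ i, ∃ z : G i, j ≤ i → ∀ k, v k i = x k • z := fun i => by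
    by_cases hi : j ≤ i
    · obtain ⟨z, hz⟩ := isSemiregularCoflat_iff.1 (hG i) n x hx (fun k => v k i) (fun c hc => by
        have := hy c hc
        simp_rw [← hv, ← map_smul] at this
        rw [← map_sum, Submodule.mkQ_apply, Submodule.Quotient.mk_eq_zero] at this
        simpa using this i hi)
      exact ⟨z, fun _ => hz⟩
    · exact ⟨0, fun h => absurd h hi⟩
  choose z hz using this
  refine ⟨(zeroFrom R G j).mkQ z, fun k => ?_⟩
  rw [← hv, ← map_smul, ← sub_eq_zero, ← map_sub, Submodule.mkQ_apply,
    Submodule.Quotient.mk_eq_zero]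
  intro i hi
  simp [hz i hi]

end

/-- Products of coflat modules along a well-order, modulo the eventually vanishing families,
are coflat. -/
def ReducedProductsCoflat : Prop :=
  ∀ (J : Type u) [LinearOrder J] [WellFoundedLT J] [NoMaxOrder J] [Nonempty J] (G : J → Type u)
    [∀ j, AddCommGroup (G j)] [∀ j, Module R (G j)], (∀ j, IsSemiregularCoflat R (G j)) →
      IsSemiregularCoflat R ((∀ j, G j) ⧸ eventuallyZero R G)

/-- Coflatness is stable under direct limits. -/
def DirectLimitsCoflat : Prop :=
  ∀ (ι : Type u) [DecidableEq ι] [Preorder ι] [IsDirectedOrder ι] [Nonempty ι]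
    (G : ι → Type u) [∀ i, AddCommGroup (G i)] [∀ i, Module R (G i)]
    (f : ∀ i j, i ≤ j → G i →ₗ[R] G j) [DirectedSystem G (fun i j h => f i j h)],
    (∀ i, IsSemiregularCoflat R (G i)) → IsSemiregularCoflat R (Module.DirectLimit G f)

variable {R}

/-- The quotient by the union is the direct limit of the quotients. Exhibiting it as a retract
suffices. -/
theorem DirectLimitsCoflat.quotient_iSup (h : DirectLimitsCoflat R) {N J : Type u}
    [AddCommGroup N] [Module R N] [Preorder J] [IsDirectedOrder J] [Nonempty J]
    {K : J → Submodule R N} (hK : Monotone K) (hN : ∀ j, IsSemiregularCoflat R (N ⧸ K j)) :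
    IsSemiregularCoflat R (N ⧸ ⨆ j, K j) := by
  classical
  let f : ∀ i j, i ≤ j → (N ⧸ K i) →ₗ[R] (N ⧸ K j) := fun i j hij => Submodule.factor (hK hij)
  have : DirectedSystem (fun j => N ⧸ K j) (fun i j h => f i j h) := by
    refine ⟨fun i q => ?_, fun i j k hij hjk q => ?_⟩ <;>
    · obtain ⟨q, rfl⟩ := Submodule.mkQ_surjective _ q
      rfl
  let j₀ : J := Classical.arbitrary J
  let p : Module.DirectLimit (fun j => N ⧸ K j) f →ₗ[R] N ⧸ ⨆ j, K j :=
    Module.DirectLimit.lift R J _ f (fun j => Submodule.factor (le_iSup K j))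
      (fun i j hij q => by
        obtain ⟨q, rfl⟩ := Submodule.mkQ_surjective _ q
        rfl)
  let s : N →ₗ[R] Module.DirectLimit (fun j => N ⧸ K j) f :=
    (Module.DirectLimit.of R J (fun j => N ⧸ K j) f j₀).comp (K j₀).mkQ
  have hs : ∀ j, s = (Module.DirectLimit.of R J (fun j => N ⧸ K j) f j).comp (K j).mkQ := fun j => by
    obtain ⟨k, hk, hk'⟩ := directed_of (· ≤ ·) j₀ j
    ext q
    change Module.DirectLimit.of R J _ f j₀ ((K j₀).mkQ q) =
      Module.DirectLimit.of R J _ f j ((K j).mkQ q)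
    rw [← Module.DirectLimit.of_f (hij := hk), ← Module.DirectLimit.of_f (hij := hk')]
    rfl
  refine (h J _ f hN).of_retract ((⨆ j, K j).liftQ s ?_) p fun q => ?_
  · refine iSup_le fun j q hq => ?_
    rw [LinearMap.mem_ker, hs j, LinearMap.comp_apply, Submodule.mkQ_apply,
      (Submodule.Quotient.mk_eq_zero _).2 hq, map_zero]
  · obtain ⟨q, rfl⟩ := Submodule.mkQ_surjective _ q
    simp [s, p, Submodule.factor]

theorem DirectLimitsCoflat.reducedProductsCoflat (h : DirectLimitsCoflat R) :
    ReducedProductsCoflat R := fun _ _ _ _ _ G _ _ hG =>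
  h.quotient_iSup (zeroFrom_mono R G) (isSemiregularCoflat_pi_quotient_zeroFrom R hG)

theorem reducedProductsCoflat_of_pure_quotient
    (h : ∀ (N : Type u) [AddCommGroup N] [Module R N] (K : Submodule R N),
        IsSemiregularCoflat R N → K.IsPureSubmodule → IsSemiregularCoflat R (N ⧸ K)) :
    ReducedProductsCoflat R := fun _ _ _ _ _ G _ _ hG =>
  h _ _ (isSemiregularCoflat_pi hG) (isPureSubmodule_eventuallyZero R G)

open Cardinal in
/-- A module that is not finitely generated is the union of a well-ordered chain of proper
submodules. -/
theorem Submodule.exists_wellOrdered_chain {V : Type u} [AddCommGroup V] [Module R V]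
    {K : Submodule R V} (hK : ¬ K.FG) :
    ∃ (J : Type u) (_ : LinearOrder J) (_ : WellFoundedLT J) (_ : NoMaxOrder J) (_ : Nonempty J)
      (L : J → Submodule R V), Monotone L ∧ (∀ j, ¬ K ≤ L j) ∧ ∀ c ∈ K, ∃ j, c ∈ L j := by
  -- The generating set has least cardinality and is enumerated along its initial ordinal. Proper
  -- initial segments are then too small to generate K.
  obtain ⟨s, hs, hmin⟩ : ∃ s : Set V, span R s = K ∧ ∀ t : Set V, span R t = K → #s ≤ #t := by
    let C : Set Cardinal.{u} := {c | ∃ s : Set V, span R s = K ∧ #s = c}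
    have hC : C.Nonempty := ⟨_, K, span_eq K, rfl⟩
    obtain ⟨s, hs, hc⟩ := csInf_mem hC
    exact ⟨s, hs, fun t ht => hc ▸ csInf_le' ⟨t, ht, rfl⟩⟩
  have hinf : ℵ₀ ≤ #s := by
    by_contra! hlt
    exact hK ⟨(Cardinal.lt_aleph0_iff_set_finite.1 hlt).toFinset, by simpa using hs⟩
  obtain ⟨e⟩ : Nonempty ((#s).ord.ToType ≃ s) := Cardinal.eq.1 (mk_ord_toType _)
  have hno := Cardinal.noMaxOrder hinf
  have hne : Nonempty (#s).ord.ToType :=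
    (Cardinal.mk_ne_zero_iff).1 (by rw [mk_ord_toType]; exact (aleph0_pos.trans_le hinf).ne')
  refine ⟨(#s).ord.ToType, inferInstance, inferInstance, hno, hne,
    fun j => span R ((fun i => (e i : V)) '' Set.Iio j), ?_, fun j hj => ?_, fun c hc => ?_⟩
  · exact fun i j hij => span_mono (Set.image_mono (Set.Iio_subset_Iio hij))
  · have h1 : span R ((fun i => (e i : V)) '' Set.Iio j) = K := by
      refine le_antisymm (span_le.2 ?_) hj
      rintro _ ⟨i, -, rfl⟩
      rw [← hs]
      exact subset_span (e i).2
    exact (hmin _ h1).not_gt (mk_image_le.trans_lt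
      ((mk_Iio_lt j (by simp)).trans_eq (mk_ord_toType _)))
  · rw [← hs] at hc
    have hd : Monotone fun j => span R ((fun i => (e i : V)) '' Set.Iio j) :=
      fun i j hij => span_mono (Set.image_mono (Set.Iio_subset_Iio hij))
    rw [← Submodule.mem_iSup_of_directed _ hd.directed_le]
    refine (span_le.2 fun v hv => ?_ : span R s ≤ _) hc
    obtain ⟨j, hj⟩ := exists_gt (e.symm ⟨v, hv⟩)
    exact mem_iSup_of_mem j (subset_span ⟨_, hj, by simp⟩)

theorem exists_injective_embedding (M : Type u) [AddCommGroup M] [Module R M] :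
    ∃ (E : Type u) (_ : AddCommGroup E) (_ : Module R E) (η : M →ₗ[R] E),
      Module.Injective R E ∧ Function.Injective η := by
  let E : ModuleCat.{u} R := Injective.under (ModuleCat.of R M)
  refine ⟨E, inferInstance, inferInstance, (Injective.ι (ModuleCat.of R M)).hom, ?_, ?_⟩
  · have : Injective (ModuleCat.of R E) := inferInstanceAs (Injective (Injective.under _))
    exact Module.injective_module_of_injective_object R E
  · exact (ModuleCat.mono_iff_injective _).1 inferInstance

/-- A solution modulo eventually zero families is an honest one at some late index i. Every relation
of `x` then vanishes in R^n/L_i, so L_i contains the whole relation module, a contradiction. -/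
theorem ReducedProductsCoflat.isSemiregularCoherent (h : ReducedProductsCoflat R) :
    IsSemiregularCoherent R := by
  rw [isSemiregularCoherent_iff]
  intro n x hx
  by_contra hK
  obtain ⟨J, _, _, _, _, L, hL, hproper, hunion⟩ := Submodule.exists_wellOrdered_chain hK
  choose G _ _ η hG hη using fun j => exists_injective_embedding (R := R) ((Fin n → R) ⧸ L j)
  let y : Fin n → (∀ j, G j) := fun k j => η j ((L j).mkQ (Pi.single k 1))
  have hy : ∀ c : Fin n → R, ∀ j, (∑ k, c k • y k) j = η j ((L j).mkQ c) := fun c j => by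
    conv_rhs => rw [pi_eq_sum_univ' c]
    simp [y]
  obtain ⟨z, hz⟩ := isSemiregularCoflat_iff.1
    (h J G fun j => isSemiregularCoflat_of_injective (hG j)) n x hx
    (fun k => (eventuallyZero R G).mkQ (y k)) (fun c hc => by
      obtain ⟨j, hj⟩ := hunion c (mem_relationModule.2 hc)
      simp_rw [← map_smul]
      rw [← map_sum, Submodule.mkQ_apply, Submodule.Quotient.mk_eq_zero, mem_eventuallyZero]
      refine ⟨j, fun i hi => ?_⟩
      rw [hy, Submodule.mkQ_apply, (Submodule.Quotient.mk_eq_zero _).2 (hL hi hj), map_zero])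
  obtain ⟨w, rfl⟩ := Submodule.mkQ_surjective _ z
  have : ∀ k, ∃ j, ∀ i, j ≤ i → y k i = x k • w i := fun k => by
    have := hz k
    rw [← map_smul, ← sub_eq_zero, ← map_sub, Submodule.mkQ_apply, Submodule.Quotient.mk_eq_zero,
      mem_eventuallyZero] at this
    simpa [sub_eq_zero] using this
  choose j hj using this
  obtain ⟨i, hi⟩ := Finite.exists_le j
  refine hproper i fun c hc => ?_
  rw [mem_relationModule] at hc
  rw [← Submodule.Quotient.mk_eq_zero, ← Submodule.mkQ_apply, ← map_eq_zero_iff _ (hη i), ← hy]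
  simp only [Finset.sum_apply, Pi.smul_apply]
  simp_rw [hj _ i (hi _), smul_smul]
  rw [← Finset.sum_smul, hc, zero_smul]

end ReducedProducts

/-! ### Reduced products from precovers, by a tree of branches -/

section Branches

open Cardinal

theorem Cardinal.exists_power_tower (J : Type u) [LinearOrder J] [WellFoundedLT J]
    (θ : Cardinal.{u}) :
    ∃ c : J → Cardinal.{u}, (∀ j, θ ≤ c j) ∧ ∀ i j, i < j → 2 ^ c i ≤ c j := by
  let F : ∀ j : J, (∀ i, i < j → Cardinal.{u}) → Cardinal.{u} := fun j ih =>
    θ + Cardinal.sum fun i : Set.Iio j => 2 ^ ih i.1 i.2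
  let c : J → Cardinal.{u} := (wellFounded_lt (α := J)).fix F
  have hc : ∀ j, c j = θ + Cardinal.sum fun i : Set.Iio j => 2 ^ c i.1 := fun j =>
    (wellFounded_lt (α := J)).fix_eq F j
  refine ⟨c, fun j => hc j ▸ self_le_add_right _ _, fun i j hij => ?_⟩
  rw [hc j]
  exact (le_sum (fun i : Set.Iio j => 2 ^ c i.1) ⟨i, hij⟩).trans (self_le_add_left _ _)

variable {J : Type u} [LinearOrder J] (B : J → Type u)

/-- The nodes at level `j`: traces of subsets of `Σ j, B j` below level `j`. -/
abbrev BranchNode (j : J) : Type u := Set {a : Σ j, B j // a.1 < j}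

variable {B} in
/-- The node at level `j` of the branch `ν`. -/
def branchNode (ν : Set (Σ j, B j)) (j : J) : BranchNode B j := Subtype.val ⁻¹' ν

variable {B} in
theorem eventually_branchNode_ne [NoMaxOrder J] {ν ν' : Set (Σ j, B j)} (h : ν ≠ ν') :
    ∃ β, ∀ j, β ≤ j → branchNode ν j ≠ branchNode ν' j := by
  obtain ⟨a, ha⟩ : ∃ a, ¬ (a ∈ ν ↔ a ∈ ν') := by
    by_contra! h'
    exact h (Set.ext h')
  obtain ⟨β, hβ⟩ := exists_gt a.1
  refine ⟨β, fun j hj h => ha ?_⟩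
  have : (⟨a, hβ.trans_le hj⟩ : {a : Σ j, B j // a.1 < j}) ∈ branchNode ν j ↔
    (⟨a, hβ.trans_le hj⟩ : {a : Σ j, B j // a.1 < j}) ∈ branchNode ν' j := by rw [h]
  exact this

variable (R : Type u) [CommRing R] (G : J → Type u) [∀ j, AddCommGroup (G j)]
  [∀ j, Module R (G j)]

/-- Families indexed by the nodes that are eventually supported on finitely many branches. -/
def branchModule [Nonempty J] : Submodule R (∀ j, BranchNode B j → G j) where
  carrier := {y | ∃ (β : J) (S : Finset (Set (Σ j, B j))), ∀ j, β ≤ j → ∀ t, y j t ≠ 0 →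
    ∃ ν ∈ S, t = branchNode ν j}
  zero_mem' := ⟨Classical.arbitrary J, ∅, by simp⟩
  add_mem' := by
    classical
    rintro a b ⟨β, S, h⟩ ⟨β', S', h'⟩
    refine ⟨max β β', S ∪ S', fun j hj t ht => ?_⟩
    by_cases ha : a j t = 0
    · have hb : b j t ≠ 0 := fun hb => ht (by simp [ha, hb])
      obtain ⟨ν, hν, rfl⟩ := h' j (le_of_max_le_right hj) t hb
      exact ⟨ν, Finset.mem_union_right _ hν, rfl⟩
    · obtain ⟨ν, hν, rfl⟩ := h j (le_of_max_le_left hj) t ha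
      exact ⟨ν, Finset.mem_union_left _ hν, rfl⟩
  smul_mem' := by
    rintro r a ⟨β, S, h⟩
    exact ⟨β, S, fun j hj t ht => h j hj t fun h0 => ht (by simp [h0])⟩

variable {R G} in
theorem mem_branchModule [Nonempty J] {y : ∀ j, BranchNode B j → G j} :
    y ∈ branchModule B R G ↔ ∃ (β : J) (S : Finset (Set (Σ j, B j))), ∀ j, β ≤ j → ∀ t, y j t ≠ 0 →
      ∃ ν ∈ S, t = branchNode ν j := Iff.rfl

variable {R G} in
-- Solve at each node, choosing 0 wherever the whole given tuple vanishes. The solution is then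
-- supported on the same finitely many branches.
theorem isSemiregularCoflat_branchModule [Nonempty J] (hG : ∀ j, IsSemiregularCoflat R (G j)) :
    IsSemiregularCoflat R (branchModule B R G) := by
  classical
  rw [isSemiregularCoflat_iff]
  intro n x hx y hy
  have : ∀ j (t : BranchNode B j), ∃ z : G j, (∀ k, (y k).1 j t = x k • z) ∧
      ((∀ k, (y k).1 j t = 0) → z = 0) := fun j t => by
    by_cases h0 : ∀ k, (y k).1 j t = 0
    · exact ⟨0, by simp [h0]⟩
    · obtain ⟨z, hz⟩ := isSemiregularCoflat_iff.1 (hG j) n x hx (fun k => (y k).1 j t)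
        (fun c hc => by
          simpa using congrArg (fun w : branchModule B R G => w.1 j t) (hy c hc))
      exact ⟨z, hz, fun h => absurd h h0⟩
  choose z hz hz0 using this
  choose β S hS using fun k => mem_branchModule B |>.1 (y k).2
  obtain ⟨γ, hγ⟩ := Finite.exists_le β
  refine ⟨⟨z, γ, Finset.univ.biUnion S, fun j hj t ht => ?_⟩, fun k => ?_⟩
  · obtain ⟨k, hk⟩ : ∃ k, (y k).1 j t ≠ 0 := by
      by_contra! h
      exact ht (hz0 j t h)
    obtain ⟨ν, hν, rfl⟩ := hS k j ((hγ k).trans hj) t hk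
    exact ⟨ν, Finset.mem_biUnion.2 ⟨k, Finset.mem_univ _, hν⟩, rfl⟩
  · ext j t
    exact hz j t k

/-- The values of a family along a branch. -/
def branchRestrict (ν : Set (Σ j, B j)) : (∀ j, BranchNode B j → G j) →ₗ[R] (∀ j, G j) where
  toFun y j := y j (branchNode ν j)
  map_add' _ _ := rfl
  map_smul' _ _ := rfl

/-- The values of a family along a branch, up to eventual equality. -/
def branchEval (ν : Set (Σ j, B j)) :
    (∀ j, BranchNode B j → G j) →ₗ[R] ((∀ j, G j) ⧸ eventuallyZero R G) :=
  (eventuallyZero R G).mkQ.comp (branchRestrict B R G ν)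

variable {R G} in
theorem branchEval_eq_zero [Nonempty J] [NoMaxOrder J] {ν : Set (Σ j, B j)}
    {y : ∀ j, BranchNode B j → G j} {β : J} {S : Finset (Set (Σ j, B j))}
    (hS : ∀ j, β ≤ j → ∀ t, y j t ≠ 0 → ∃ ν ∈ S, t = branchNode ν j) (hν : ν ∉ S) :
    branchEval B R G ν y = 0 := by
  change (eventuallyZero R G).mkQ (fun j => y j (branchNode ν j)) = 0
  rw [Submodule.mkQ_apply, Submodule.Quotient.mk_eq_zero, mem_eventuallyZero]
  choose γ hγ using fun μ : S => eventually_branchNode_ne (B := B)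
    (show ν ≠ μ.1 from fun h => hν (h ▸ μ.2))
  obtain ⟨δ, hδ⟩ := Finite.exists_le γ
  refine ⟨max β δ, fun j hj => ?_⟩
  by_contra h
  obtain ⟨μ, hμ, h'⟩ := hS j (le_of_max_le_left hj) _ h
  exact hγ ⟨μ, hμ⟩ j ((hδ _).trans (le_of_max_le_right hj)) h'

/-- The family of all readings along branches, finitely supported on `branchModule`. -/
noncomputable def branchEvalFinsupp [Nonempty J] [NoMaxOrder J] :
    branchModule B R G →ₗ[R] (Set (Σ j, B j) →₀ ((∀ j, G j) ⧸ eventuallyZero R G)) where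
  toFun y := Finsupp.ofSupportFinite (fun ν => branchEval B R G ν y.1) (by
    obtain ⟨β, S, hS⟩ := (mem_branchModule B).1 y.2
    refine S.finite_toSet.subset fun ν hν => ?_
    by_contra h
    exact hν (branchEval_eq_zero B hS h))
  map_add' a b := by
    ext ν : 1
    exact map_add (branchEval B R G ν) a.1 b.1
  map_smul' r a := by
    ext ν : 1
    exact map_smul (branchEval B R G ν) r a.1

open Classical in
/-- Placing a family along a branch. -/
noncomputable def branchSingle [Nonempty J] (ν : Set (Σ j, B j)) :
    (∀ j, G j) →ₗ[R] branchModule B R G where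
  toFun x := ⟨fun j t => if t = branchNode ν j then x j else 0,
    Classical.arbitrary J, {ν}, fun j _ t ht => ⟨ν, by simp, by
      by_contra h
      exact ht (by simp [h])⟩⟩
  map_add' x y := by
    ext j t
    by_cases h : t = branchNode ν j <;> simp [h]
  map_smul' r x := by
    ext j t
    by_cases h : t = branchNode ν j <;> simp [h]

variable {R G} in
theorem branchSingle_self [Nonempty J] (ν : Set (Σ j, B j)) (x : ∀ j, G j) (j : J) :
    (branchSingle B R G ν x).1 j (branchNode ν j) = x j := by
  simp [branchSingle]

variable {R G} in
theorem branchSingle_of_ne [Nonempty J] (ν : Set (Σ j, B j)) (x : ∀ j, G j) (j : J)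
    (t : BranchNode B j) (h : t ≠ branchNode ν j) : (branchSingle B R G ν x).1 j t = 0 := by
  simp [branchSingle, h]

variable {R G} in
theorem branchEvalFinsupp_branchSingle [Nonempty J] [NoMaxOrder J] (ν : Set (Σ j, B j))
    (x : ∀ j, G j) : branchEvalFinsupp B R G (branchSingle B R G ν x) =
      Finsupp.single ν ((eventuallyZero R G).mkQ x) := by
  classical
  ext ν' : 1
  by_cases h : ν' = ν
  · subst h
    rw [Finsupp.single_eq_same]
    change (eventuallyZero R G).mkQ
      (fun j => (branchSingle B R G ν' x).1 j (branchNode ν' j)) = _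
    simp_rw [branchSingle_self]
  · rw [Finsupp.single_eq_of_ne h]
    refine branchEval_eq_zero (β := Classical.arbitrary J) (S := {ν}) B (fun j _ t ht => ?_)
      (by simpa using h)
    refine ⟨ν, by simp, ?_⟩
    by_contra h'
    exact ht (branchSingle_of_ne B ν x j t h')

theorem eventuallyZero_le_branchModule [Nonempty J] :
    eventuallyZero R (fun j => BranchNode B j → G j) ≤ branchModule B R G := by
  intro y hy
  obtain ⟨β, hβ⟩ := mem_eventuallyZero.1 hy
  exact ⟨β, ∅, fun j hj t ht => absurd (congrFun (hβ j hj) t) ht⟩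

variable {R G} in
theorem branchSingle_mem_eventuallyZero [Nonempty J] (ν : Set (Σ j, B j)) {x : ∀ j, G j}
    (hx : x ∈ eventuallyZero R G) :
    (branchSingle B R G ν x).1 ∈ eventuallyZero R (fun j => BranchNode B j → G j) := by
  obtain ⟨β, hβ⟩ := mem_eventuallyZero.1 hx
  refine mem_eventuallyZero.2 ⟨β, fun j hj => funext fun t => ?_⟩
  by_cases h : t = branchNode ν j
  · subst h
    rw [branchSingle_self, hβ j hj]; rfl
  · exact branchSingle_of_ne B ν x j t h

variable {B G} in
-- An eventually zero family lives below some level β. There are at most 2^(2^|B β|) such families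
-- for each β, which the tower condition absorbs two levels higher.
theorem mk_eventuallyZero_branchNode_le [NoMaxOrder J] [Nonempty J] {θ : Cardinal.{u}}
    (hθ : ℵ₀ ≤ θ) (hJ : #J ≤ θ) (hG : ∀ j, #(G j) ≤ θ) (hB : ∀ j, θ ≤ #(B j))
    (hpow : ∀ i j, i < j → 2 ^ #(B i) ≤ #(B j)) :
    #(eventuallyZero R (fun j => BranchNode B j → G j)) ≤ #(Σ j, B j) := by
  classical
  have hle : ∀ j, #(B j) ≤ #(Σ j, B j) := fun j =>
    mk_le_of_injective (f := fun b => (⟨j, b⟩ : Σ j, B j)) fun b b' h => by simpa using h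
  have hA : θ ≤ #(Σ j, B j) := (hB (Classical.arbitrary J)).trans (hle _)
  have hBmono : ∀ i j, i ≤ j → #(B i) ≤ #(B j) := fun i j h => by
    rcases h.eq_or_lt with rfl | h
    · exact le_rfl
    · exact (cantor _).le.trans (hpow i j h)
  have hlevel : ∀ β : J, #(∀ j : Set.Iio β, BranchNode B j.1 → G j.1) ≤ #(Σ j, B j) := by
    intro β
    have hBβ : ℵ₀ ≤ #(B β) := hθ.trans (hB β)
    have h2 : ℵ₀ ≤ 2 ^ #(B β) := hBβ.trans (cantor _).le
    have hnode : ∀ j : Set.Iio β, #(BranchNode B j.1) ≤ 2 ^ #(B β) := fun j => by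
      rw [mk_set]
      refine power_le_power_left two_ne_zero ?_
      have h3 : #{a : Σ j, B j // a.1 < j.1} ≤ #(Σ i : Set.Iio β, B i.1) :=
        mk_le_of_injective (f := fun a => ⟨⟨a.1.1, a.2.trans j.2⟩, a.1.2⟩) (by
          rintro ⟨⟨i, a⟩, ha⟩ ⟨⟨i', a'⟩, ha'⟩ h
          simp only [Sigma.mk.injEq] at h
          obtain ⟨h0, h⟩ := h
          obtain rfl : i = i' := congrArg Subtype.val h0
          obtain rfl := eq_of_heq h
          rfl)
      refine h3.trans ?_
      rw [mk_sigma]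
      refine (sum_le_sum _ (fun _ => #(B β)) fun i => hBmono _ _ i.2.le).trans ?_
      rw [sum_const']
      refine (mul_le_mul' ((mk_set_le _).trans (hJ.trans (hB β))) le_rfl).trans ?_
      rw [mul_eq_self hBβ]
    have hfun : ∀ j : Set.Iio β, #(BranchNode B j.1 → G j.1) ≤ (2 : Cardinal.{u}) ^ ((2 : Cardinal.{u}) ^ #(B β)) := fun j => by
      rw [← power_def]
      calc #(G j.1) ^ #(BranchNode B j.1) ≤ ((2 : Cardinal.{u}) ^ #(B β)) ^ #(BranchNode B j.1) :=
            power_le_power_right (((hG _).trans (hB β)).trans (cantor _).le)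
        _ ≤ ((2 : Cardinal.{u}) ^ #(B β)) ^ ((2 : Cardinal.{u}) ^ #(B β)) :=
            power_le_power_left (power_ne_zero _ two_ne_zero) (hnode j)
        _ = (2 : Cardinal.{u}) ^ ((2 : Cardinal.{u}) ^ #(B β)) := by
            rw [← power_mul, mul_eq_right h2 (cantor _).le (aleph0_pos.trans_le hBβ).ne']
    obtain ⟨β', h'⟩ := exists_gt β
    obtain ⟨β'', h''⟩ := exists_gt β'
    rw [mk_pi]
    calc prod (fun j : Set.Iio β => #(BranchNode B j.1 → G j.1))
        ≤ prod fun _ : Set.Iio β => (2 : Cardinal.{u}) ^ ((2 : Cardinal.{u}) ^ #(B β)) := prod_le_prod _ _ hfun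
      _ = ((2 : Cardinal.{u}) ^ ((2 : Cardinal.{u}) ^ #(B β))) ^ #(Set.Iio β) := by rw [prod_const']
      _ ≤ ((2 : Cardinal.{u}) ^ ((2 : Cardinal.{u}) ^ #(B β))) ^ #(B β) :=
          power_le_power_left (power_ne_zero _ two_ne_zero) ((mk_set_le _).trans (hJ.trans (hB β)))
      _ = (2 : Cardinal.{u}) ^ ((2 : Cardinal.{u}) ^ #(B β)) := by
          rw [← power_mul, mul_eq_left h2 (cantor _).le (aleph0_pos.trans_le hBβ).ne']
      _ ≤ (2 : Cardinal.{u}) ^ #(B β') := power_le_power_left two_ne_zero (hpow _ _ h')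
      _ ≤ #(B β'') := hpow _ _ h''
      _ ≤ _ := hle _
  let e : (Σ β : J, ∀ j : Set.Iio β, BranchNode B j.1 → G j.1) →
      eventuallyZero R (fun j => BranchNode B j → G j) := fun p =>
    ⟨fun j => if h : j < p.1 then p.2 ⟨j, h⟩ else 0,
      mem_eventuallyZero.2 ⟨p.1, fun j hj => by simp [not_lt.2 hj]⟩⟩
  have he : Function.Surjective e := by
    intro y
    obtain ⟨β, hβ⟩ := mem_eventuallyZero.1 y.2
    refine ⟨⟨β, fun j => y.1 j.1⟩, Subtype.ext (funext fun j => ?_)⟩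
    by_cases h : j < β
    · simp [e, h]
    · simp [e, h, hβ j (not_lt.1 h)]
  refine (mk_le_of_surjective he).trans ?_
  rw [mk_sigma]
  refine (sum_le_sum _ (fun _ => #(Σ j, B j)) hlevel).trans ?_
  rw [sum_const', mul_eq_right (hθ.trans hA) (hJ.trans hA) (mk_ne_zero J)]

variable {R G} in
-- Let A be the set whose subsets are the branches. Each set s of branches gives a map from the
-- branch module to the reduced product, summing the values along branches in s, and it lifts to F.
-- There are 2^(2^|A|) sets s, but at most 2^|A| restrictions of lifts to the eventually zero
-- families. Hence two lifts agree there, for sets differing at some branch ν.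
theorem isSemiregularCoflat_reducedProduct_of_precover [WellFoundedLT J] [NoMaxOrder J]
    [Nonempty J] (hG : ∀ j, IsSemiregularCoflat R (G j)) {F : ModuleCat.{u} R}
    {f : F ⟶ ModuleCat.of R ((∀ j, G j) ⧸ eventuallyZero R G)}
    (hf : IsPrecover (semiregularCoflatClass R) f) :
    IsSemiregularCoflat R ((∀ j, G j) ⧸ eventuallyZero R G) := by
  classical
  let θ : Cardinal.{u} := ℵ₀ + #J + #(Σ j, G j) + #F
  have hθ₀ : ℵ₀ ≤ θ := by
    simp only [θ, add_assoc]; exact self_le_add_right _ _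
  have hθJ : #J ≤ θ :=
    (self_le_add_left _ _).trans ((self_le_add_right _ _).trans (self_le_add_right _ _))
  have hθG : ∀ j, #(G j) ≤ θ := fun j =>
    (mk_le_of_injective (f := fun b => (⟨j, b⟩ : Σ j, G j)) fun b b' h => by simpa using h).trans
      ((self_le_add_left _ _).trans (self_le_add_right _ _))
  have hθF : #F ≤ θ := self_le_add_left _ _
  obtain ⟨c, hc, hpow⟩ := Cardinal.exists_power_tower J θ
  let B : J → Type u := fun j => (c j).out
  have hB : ∀ j, #(B j) = c j := fun j => mk_out _
  let A := Σ j, B j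
  let D := eventuallyZero R (fun j => BranchNode B j → G j)
  have hD : #D ≤ #A := mk_eventuallyZero_branchNode_le R hθ₀ hθJ hθG
    (fun j => by rw [hB]; exact hc j) (fun i j h => by rw [hB, hB]; exact hpow i j h)
  have hA : θ ≤ #A := (hc (Classical.arbitrary J)).trans (by
    rw [← hB]
    exact mk_le_of_injective (f := fun b => (⟨_, b⟩ : Σ j, B j)) fun b b' h =>
      eq_of_heq (Sigma.mk.inj h).2)
  let g : Set (Set A) → branchModule B R G →ₗ[R] ((∀ j, G j) ⧸ eventuallyZero R G) := fun s =>
    (Finsupp.lsum R fun ν => if ν ∈ s then LinearMap.id else 0).comp (branchEvalFinsupp B R G)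
  have hg : ∀ s ν x, g s (branchSingle B R G ν x) =
      if ν ∈ s then (eventuallyZero R G).mkQ x else 0 := fun s ν x => by
    rw [LinearMap.comp_apply, branchEvalFinsupp_branchSingle, Finsupp.lsum_single]
    split_ifs <;> rfl
  choose lift hlift using fun s => hf.2 (ModuleCat.of R (branchModule B R G))
    (ModuleCat.ofHom (g s)) (isSemiregularCoflat_branchModule B hG)
  have hlift' : ∀ s y, f.hom ((lift s).hom y) = g s y := fun s y =>
    congrArg (fun k => k.hom y) (hlift s)
  let res : Set (Set A) → D → F := fun s d =>
    (lift s).hom ⟨d.1, eventuallyZero_le_branchModule B R G d.2⟩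
  obtain ⟨s, s', hss', hne⟩ : ∃ s s', res s = res s' ∧ s ≠ s' := by
    by_contra! h
    have h1 : #(Set (Set A)) ≤ #(D → F) := mk_le_of_injective (f := res) fun s s' => h s s'
    refine h1.not_gt ?_
    rw [mk_set, mk_set, ← power_def]
    calc #F ^ #D ≤ ((2 : Cardinal.{u}) ^ #A) ^ #D := power_le_power_right ((hθF.trans hA).trans (cantor _).le)
      _ ≤ ((2 : Cardinal.{u}) ^ #A) ^ #A := power_le_power_left (power_ne_zero _ two_ne_zero) hD
      _ = (2 : Cardinal.{u}) ^ #A := by rw [← power_mul, mul_eq_self (hθ₀.trans hA)]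
      _ < (2 : Cardinal.{u}) ^ (2 : Cardinal.{u}) ^ #A := cantor _
  obtain ⟨s, s', hss', ν, hν, hν'⟩ : ∃ s s', res s = res s' ∧ ∃ ν, ν ∈ s ∧ ν ∉ s' := by
    by_cases h : s ⊆ s'
    · obtain ⟨ν, hν, hν'⟩ := Set.not_subset.1 fun h' => hne (h.antisymm h')
      exact ⟨s', s, hss'.symm, ν, hν, hν'⟩
    · obtain ⟨ν, hν, hν'⟩ := Set.not_subset.1 h
      exact ⟨s, s', hss', ν, hν, hν'⟩
  -- Along ν the difference of the two lifts kills eventually zero families and covers the quotient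
  -- map, so it descends to a section of `f`.
  let δ : (∀ j, G j) →ₗ[R] F := ((lift s).hom - (lift s').hom).comp (branchSingle B R G ν)
  refine IsSemiregularCoflat.of_retract (N := F) hf.1
    ((eventuallyZero R G).liftQ δ fun x hx => ?_) f.hom fun q => ?_
  · have := congrFun hss' ⟨_, branchSingle_mem_eventuallyZero B ν hx⟩
    exact sub_eq_zero.2 this
  · obtain ⟨x, rfl⟩ := Submodule.mkQ_surjective _ q
    change f.hom ((lift s).hom (branchSingle B R G ν x) - (lift s').hom (branchSingle B R G ν x)) = _
    rw [map_sub, hlift', hlift', hg, hg, if_pos hν, if_neg hν', sub_zero]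

theorem IsPrecoveringClass.reducedProductsCoflat
    (h : IsPrecoveringClass (semiregularCoflatClass R)) : ReducedProductsCoflat R :=
  fun _ _ _ _ _ _ _ _ hG =>
    let ⟨_, _, hf⟩ := h _
    isSemiregularCoflat_reducedProduct_of_precover hG hf

end Branches

/-! ### Pure submodules in kernels of maps to small modules -/

section SmallSubmodules

open Cardinal

/-- Closing up under a family of operations with controlled arities. -/
theorem exists_closed_set_mk_le {N Q : Type u} (β : Q → Type u) (op : ∀ q, (β q → N) → N)
    {κ : Cardinal.{u}} (hκ : #(WType β) ≤ κ) :
    ∃ S : Set N, #S ≤ κ ∧ ∀ q (p : β q → N), (∀ i, p i ∈ S) → op q p ∈ S := by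
  -- The values of all well-founded formal terms form a closed set no larger than the set of terms.
  refine ⟨Set.range (WType.elim N fun a => op a.1 a.2), mk_range_le.trans hκ, fun q p hp => ?_⟩
  choose w hw using hp
  exact ⟨WType.mk q w, by simp [WType.elim, hw]⟩

variable {R : Type u} [CommRing R]

/-- Every element lies in a small submodule that reflects solvability modulo `N'` of finite linear
systems. -/
theorem exists_small_submodule_reflecting {N : Type u} [AddCommGroup N] [Module R N] (N' : Set N)
    (x : N) {c : Cardinal.{u}} (hc : ℵ₀ ≤ c) (hR : #R ≤ c) :
    ∃ S : Submodule R N, x ∈ S ∧ #S ≤ c ∧ ∀ (n m : ℕ) (A : Fin m → Fin n → R) (b : Fin m → N),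
      (∀ j, b j ∈ S) → (∃ u : Fin n → N, ∀ j, b j - ∑ i, A j i • u i ∈ N') →
        ∃ u : Fin n → N, (∀ i, u i ∈ S) ∧ ∀ j, b j - ∑ i, A j i • u i ∈ N' := by
  classical
  let Sys : Type u := Σ n : ℕ, Σ m : ℕ, (Fin m → Fin n → R) × Fin n
  let Q : Type u := Option (R ⊕ Sys)
  let β : Q → Type u := fun q => match q with
    | none => PEmpty
    | some (Sum.inl _) => ULift Bool
    | some (Sum.inr s) => ULift (Fin s.2.1)
  let op : ∀ q, (β q → N) → N := fun q => match q with
    | none => fun _ => x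
    | some (Sum.inl r) => fun p => r • p ⟨true⟩ + p ⟨false⟩
    | some (Sum.inr s) => fun p =>
        if h : ∃ u : Fin s.1 → N, ∀ j, p ⟨j⟩ - ∑ i, s.2.2.1 j i • u i ∈ N' then
          h.choose s.2.2.2 else x
  have hfin : ∀ q, Finite (β q) := fun q => match q with
    | none => inferInstanceAs (Finite PEmpty)
    | some (Sum.inl _) => inferInstanceAs (Finite (ULift Bool))
    | some (Sum.inr s) => inferInstanceAs (Finite (ULift (Fin s.2.1)))
  have hSys : #Sys ≤ c := by
    have h1 : ∀ n m : ℕ, #((Fin m → Fin n → R) × Fin n) ≤ c := fun n m => by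
      rw [mk_prod]
      refine (mul_le_mul' (b := c) (d := c) ?_ ?_).trans_eq (mul_eq_self hc)
      · simp only [mk_pi, prod_const, mk_fin, lift_natCast, lift_uzero]
        exact (power_le_power_right ((power_le_power_right hR).trans (power_nat_le hc))).trans
          (power_nat_le hc)
      · simpa using (natCast_lt_aleph0.le.trans hc)
    have h2 : ∀ (f : ℕ → Type u), (∀ n, #(f n) ≤ c) → #(Σ n, f n) ≤ c := fun f hf => by
      rw [← (Equiv.sigmaCongrLeft' (β := f) Equiv.ulift.{u}.symm).symm.cardinal_eq, mk_sigma]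
      refine (sum_le_sum _ (fun _ => c) fun i => hf _).trans ?_
      rw [sum_const']
      simpa using mul_le_mul' hc (le_refl c) |>.trans_eq (mul_eq_self hc)
    exact h2 _ fun n => h2 _ fun m => h1 n m
  have hQ : #(WType β) ≤ c := by
    refine WType.cardinalMk_le_max_aleph0_of_finite.trans (max_le ?_ hc)
    rw [mk_option, mk_sum, lift_id, lift_id]
    exact add_le_of_le hc (add_le_of_le hc hR hSys) (one_le_aleph0.trans hc)
  obtain ⟨T, hT, hcl⟩ := exists_closed_set_mk_le β op hQ
  have hx : x ∈ T := hcl none PEmpty.elim (fun i => i.elim)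
  have hlin : ∀ (r : R) a b, a ∈ T → b ∈ T → r • a + b ∈ T := fun r a b ha hb =>
    hcl (some (Sum.inl r)) (fun i => if i.down then a else b) (by
      rintro ⟨_ | _⟩
      · exact hb
      · exact ha)
  have h0 : (0 : N) ∈ T := by simpa using hlin (-1) x x hx hx
  let S : Submodule R N :=
    { carrier := T
      zero_mem' := h0
      add_mem' := fun {a b} ha hb => by simpa using hlin 1 a b ha hb
      smul_mem' := fun r a ha => by simpa using hlin r a 0 ha h0 }
  refine ⟨S, hx, hT, fun n m A b hb h => ⟨h.choose, fun i => ?_, h.choose_spec⟩⟩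
  have := hcl (some (Sum.inr ⟨n, m, A, i⟩)) (fun j => b j.down) (fun j => hb _)
  have h' : op (some (Sum.inr ⟨n, m, A, i⟩)) (fun j => b j.down) = h.choose i := dif_pos h
  rw [h'] at this
  exact this

/-- A small subset realizing the isomorphism types over itself and over `M` of all small families
of elements. -/
theorem exists_small_set_realizing {N M : Type u} [AddCommGroup N] [Module R N] [AddCommGroup M]
    [Module R M] (g : N →ₗ[R] M) (Λ : Type u) [Infinite Λ] (hR : #R ≤ #Λ) (hM : #M ≤ #Λ) :
    ∃ N' : Set N, #N' ≤ 2 ^ #Λ ∧ ∀ s : Λ → N, ∃ s' : Λ → N, (∀ i, s' i ∈ N') ∧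
      (∀ r : Λ →₀ R, Finsupp.linearCombination R s r = 0 →
        Finsupp.linearCombination R s' r = 0) ∧
      (∀ i, g (s' i) = g (s i)) ∧ ∀ i, s i ∈ N' → s' i = s i := by
  classical
  have hΛ : ℵ₀ ≤ #Λ := aleph0_le_mk Λ
  have h2 : ℵ₀ ≤ 2 ^ #Λ := hΛ.trans (cantor _).le
  -- A query prescribes relations, images under `g`, the positions whose values are already given,
  -- and the coordinate asked for. The given values are the arguments of the operation.
  let Q : Type u := (Set (Λ →₀ R) × (Λ → M) × Set Λ) × Λ
  let β : Q → Type u := fun q => q.1.2.2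
  let Real : ∀ q : Q, (β q → N) → (Λ → N) → Prop := fun q p s' =>
    (∀ r ∈ q.1.1, Finsupp.linearCombination R s' r = 0) ∧ (∀ i, g (s' i) = q.1.2.1 i) ∧
      ∀ i : β q, s' i.1 = p i
  let op : ∀ q, (β q → N) → N := fun q p =>
    if h : ∃ s', Real q p s' then h.choose q.2 else 0
  have hfs : #(Λ →₀ R) ≤ #Λ := by
    rcases subsingleton_or_nontrivial R with h | h
    · exact (le_one_iff_subsingleton.2 inferInstance).trans (one_le_aleph0.trans hΛ)
    · rw [mk_finsupp_of_infinite]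
      exact max_le le_rfl hR
  have hQ : #Q ≤ 2 ^ #Λ := by
    simp only [Q, mk_prod, lift_id, mk_set]
    have h3 : #(Λ → M) ≤ 2 ^ #Λ := by
      rw [← power_def]
      refine (power_le_power_right (hM.trans (cantor _).le)).trans_eq ?_
      rw [← power_mul, mul_eq_self hΛ]
    exact mul_le_of_le h2 (mul_le_of_le h2 (power_le_power_left two_ne_zero hfs)
      (mul_le_of_le h2 h3 le_rfl)) (cantor _).le
  have hW : #(WType β) ≤ 2 ^ #Λ := by
    refine WType.cardinalMk_le_of_le ((sum_le_sum _ (fun _ => 2 ^ #Λ) fun q => ?_).trans ?_)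
    · refine (power_le_power_left (power_ne_zero _ two_ne_zero) (mk_set_le _)).trans_eq ?_
      rw [← power_mul, mul_eq_self hΛ]
    · rw [sum_const']
      exact (mul_le_mul' hQ le_rfl).trans_eq (mul_eq_self h2)
  obtain ⟨N', hN', hcl⟩ := exists_closed_set_mk_le β op hW
  refine ⟨N', hN', fun s => ?_⟩
  let q : Λ → Q := fun k =>
    (({r | Finsupp.linearCombination R s r = 0}, fun i => g (s i), {i | s i ∈ N'}), k)
  let p : {i | s i ∈ N'} → N := fun i => s i.1
  have hex : ∀ k, ∃ s', Real (q k) p s' := fun k => ⟨s, fun r hr => hr, fun i => rfl, fun i => rfl⟩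
  let k₀ : Λ := Classical.arbitrary Λ
  obtain ⟨h3, h4, h5⟩ := (hex k₀).choose_spec
  refine ⟨(hex k₀).choose, fun k => ?_, h3, h4, fun i hi => h5 ⟨i, hi⟩⟩
  have h6 := hcl (q k) p (fun i => i.2)
  have h7 : op (q k) p = (hex k).choose k := dif_pos (hex k)
  rw [h7] at h6
  exact h6

/-- The kernel of a homomorphism from a large module to a small one contains a nonzero pure
submodule. -/
theorem exists_isEquationallyPure_le_ker {N M : Type u} [AddCommGroup N] [Module R N]
    [AddCommGroup M] [Module R M] (g : N →ₗ[R] M) (Λ : Type u) [Infinite Λ] (hR : #R ≤ #Λ)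
    (hM : #M ≤ #Λ) (hN : 2 ^ #Λ < #N) :
    ∃ P : Submodule R N, P ≠ ⊥ ∧ P ≤ LinearMap.ker g ∧ P.IsEquationallyPure := by
  obtain ⟨N', hN', hreal⟩ := exists_small_set_realizing g Λ hR hM
  obtain ⟨x, hx⟩ : ∃ x, x ∉ N' := by
    by_contra! h
    rw [Set.eq_univ_of_forall h, mk_univ] at hN'
    exact hN'.not_gt hN
  obtain ⟨S, hxS, hS, hsys⟩ := exists_small_submodule_reflecting N' x (aleph0_le_mk Λ) hR
  obtain ⟨e⟩ : Nonempty (S ↪ Λ) := hS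
  have : Nonempty S := ⟨⟨x, hxS⟩⟩
  let s : Λ → N := fun i => (Function.invFun e i : S)
  have hs : ∀ y ∈ S, ∃ i, s i = y := fun y hy =>
    ⟨e ⟨y, hy⟩, by simp [s, Function.leftInverse_invFun e.injective _]⟩
  have hsS : ∀ i, s i ∈ S := fun i => (Function.invFun e i : S).2
  obtain ⟨s', hs'N, hs'rel, hs'g, hs'fix⟩ := hreal s
  obtain ⟨ψ, hψ⟩ := (Finsupp.linearCombination R s).exists_range_factor
    (Finsupp.linearCombination R s') hs'rel
  have hr : LinearMap.range (Finsupp.linearCombination R s) = S := by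
    rw [Finsupp.range_linearCombination]
    refine le_antisymm (Submodule.span_le.2 ?_) fun y hy => ?_
    · rintro _ ⟨i, rfl⟩
      exact hsS i
    · obtain ⟨i, rfl⟩ := hs y hy
      exact Submodule.subset_span ⟨i, rfl⟩
  let θ : S →ₗ[R] N := ψ.comp (LinearEquiv.ofEq _ _ hr.symm).toLinearMap
  have hθ : ∀ i, θ ⟨s i, hsS i⟩ = s' i := fun i => by
    have h1 : Finsupp.linearCombination R s (Finsupp.single i 1) = s i := by simp
    have h2 := hψ (Finsupp.single i 1) ⟨_, rfl⟩
    have h3 : (LinearEquiv.ofEq _ _ hr.symm) ⟨s i, hsS i⟩ =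
      (⟨Finsupp.linearCombination R s (Finsupp.single i 1), ⟨_, rfl⟩⟩ :
        LinearMap.range (Finsupp.linearCombination R s)) := Subtype.ext h1.symm
    rw [LinearMap.comp_apply, LinearEquiv.coe_coe, h3, h2]
    simp
  have hθN : ∀ y : S, θ y ∈ N' := fun y => by
    obtain ⟨y, hy⟩ := y
    obtain ⟨i, rfl⟩ := hs y hy
    rw [hθ]; exact hs'N i
  have hθg : ∀ y : S, g (θ y) = g y := fun y => by
    obtain ⟨y, hy⟩ := y
    obtain ⟨i, rfl⟩ := hs y hy
    rw [hθ]; exact hs'g i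
  have hθfix : ∀ y : S, (y : N) ∈ N' → θ y = y := fun y hy' => by
    obtain ⟨y, hy⟩ := y
    obtain ⟨i, rfl⟩ := hs y hy
    rw [hθ]; exact hs'fix i hy'
  -- The map θ copies S into `N'` over M and fixes S ∩ N'. So id - θ lands in the kernel of `g`, and
  -- it is nonzero at x because x ∉ N'.
  let D : S →ₗ[R] N := S.subtype - θ
  have hD : ∀ y, D y = y - θ y := fun y => rfl
  refine ⟨LinearMap.range D, fun h => ?_, ?_, ?_⟩
  · have h1 : D ⟨x, hxS⟩ = 0 := by
      rw [← Submodule.mem_bot R, ← h]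
      exact ⟨_, rfl⟩
    rw [hD, sub_eq_zero] at h1
    have h2 : x = θ ⟨x, hxS⟩ := h1
    exact hx (h2.symm ▸ hθN ⟨x, hxS⟩)
  · rintro _ ⟨y, rfl⟩
    rw [LinearMap.mem_ker, hD, map_sub, hθg, sub_self]
  · intro n m A u hu
    choose b hb using hu
    obtain ⟨w, hwS, hw⟩ := hsys n m A (fun j => b j) (fun j => (b j).2) ⟨u, fun j => by
      rw [← hb, hD, sub_sub_cancel]
      exact hθN _⟩
    refine ⟨fun i => D ⟨w i, hwS i⟩, fun i => ⟨_, rfl⟩, fun j => ?_⟩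
    -- The reflected solution `w` in S leaves a remainder in S ∩ N', which `D` kills. Applying `D`
    -- therefore solves the system inside its range.
    have h1 := hθfix (b j - ∑ i, A j i • ⟨w i, hwS i⟩) (by simpa using hw j)
    have h2 : D (b j - ∑ i, A j i • ⟨w i, hwS i⟩) = 0 := by rw [hD, h1, sub_self]
    rw [map_sub, sub_eq_zero, map_sum] at h2
    rw [← hb, h2]
    simp_rw [map_smul]

end SmallSubmodules

/-! ### Existence of precovers over coherent rings -/

section Precovers

open Cardinal

variable {R : Type u} [CommRing R]

theorem IsSemiregularCoherent.directLimitsCoflat (h : IsSemiregularCoherent R) :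
    DirectLimitsCoflat R := fun _ _ _ _ _ G _ _ f _ hG => h.isSemiregularCoflat_directLimit G f hG

theorem IsSemiregularCoflat.of_equiv {M N : Type u} [AddCommGroup M] [Module R M]
    [AddCommGroup N] [Module R N] (hN : IsSemiregularCoflat R N) (e : N ≃ₗ[R] M) :
    IsSemiregularCoflat R M :=
  hN.of_retract e.symm.toLinearMap e.toLinearMap (by simp)

/-- A homomorphism from a coflat module to `M` factors through a coflat quotient whose size is
bounded in terms of `M`. -/
theorem IsSemiregularCoherent.exists_small_quotient (h : IsSemiregularCoherent R) {N M : Type u}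
    [AddCommGroup N] [Module R N] [AddCommGroup M] [Module R M] (g : N →ₗ[R] M) (Λ : Type u)
    [Infinite Λ] (hR : #R ≤ #Λ) (hM : #M ≤ #Λ) (hN : IsSemiregularCoflat R N) :
    ∃ P : Submodule R N, P ≤ LinearMap.ker g ∧ IsSemiregularCoflat R (N ⧸ P) ∧
      #(N ⧸ P) ≤ 2 ^ #Λ := by
  obtain ⟨P, -, hP⟩ := zorn_le_nonempty₀
    {P : Submodule R N | P ≤ LinearMap.ker g ∧ IsSemiregularCoflat R (N ⧸ P)} (by
      intro c hc hchain P hP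
      have : Nonempty c := ⟨⟨P, hP⟩⟩
      have : IsDirectedOrder c := ⟨fun a b => by
        rcases hchain.total a.2 b.2 with hab | hab
        · exact ⟨b, hab, le_rfl⟩
        · exact ⟨a, le_rfl, hab⟩⟩
      refine ⟨⨆ Q : c, Q.1, ⟨iSup_le fun Q => (hc Q.2).1, ?_⟩,
        fun Q hQ => le_iSup (fun Q : c => Q.1) ⟨Q, hQ⟩⟩
      exact h.directLimitsCoflat.quotient_iSup (K := fun Q : c => Q.1) (fun a b hab => hab)
        fun Q => (hc Q.2).2) ⊥
    ⟨bot_le, hN.of_equiv (Submodule.quotEquivOfEqBot ⊥ rfl).symm⟩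
  refine ⟨P, hP.1.1, hP.1.2, ?_⟩
  by_contra! hlt
  -- If the quotient by the maximal `P` were too large, a nonzero pure submodule in the kernel would
  -- allow enlarging `P`.
  obtain ⟨P', hne, hle, hpure⟩ := exists_isEquationallyPure_le_ker (P.liftQ g hP.1.1) Λ hR hM hlt
  have hco := h.isSemiregularCoflat_quotient hP.1.2 hpure
  let T := P'.comap P.mkQ
  have hPT : P ≤ T := fun x hx => by
    rw [Submodule.mem_comap, Submodule.mkQ_apply, (Submodule.Quotient.mk_eq_zero P).2 hx]
    exact zero_mem _
  have hmap : T.map P.mkQ = P' := Submodule.map_comap_eq_of_surjective P.mkQ_surjective P'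
  rw [← hmap] at hco
  have hT : IsSemiregularCoflat R (N ⧸ T) :=
    hco.of_equiv (Submodule.quotientQuotientEquivQuotient P T hPT)
  have hTg : T ≤ LinearMap.ker g := fun x hx => by
    have := hle hx
    simpa using this
  have hTP := hP.2 ⟨hTg, hT⟩ hPT
  apply hne
  rw [← hmap, eq_bot_iff, Submodule.map_le_iff_le_comap]
  intro x hx
  rw [Submodule.mem_comap, Submodule.mkQ_apply, (Submodule.Quotient.mk_eq_zero P).2 (hTP hx)]
  exact zero_mem _

theorem isSemiregularCoflat_directSum {ι : Type u} {G : ι → Type u} [∀ i, AddCommGroup (G i)]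
    [∀ i, Module R (G i)] (hG : ∀ i, IsSemiregularCoflat R (G i)) :
    IsSemiregularCoflat R (DirectSum ι G) := by
  classical
  rw [isSemiregularCoflat_iff]
  intro n x hx y hy
  choose z hz using fun i => isSemiregularCoflat_iff.1 (hG i) n x hx (fun k => y k i)
    (fun c hc => by
      have := congrArg (fun w => DirectSum.component R ι G i w) (hy c hc)
      rw [map_sum, map_zero] at this
      simp only [map_smul] at this
      exact this)
  let s : Finset ι := Finset.univ.biUnion fun k => DFinsupp.support (y k)
  refine ⟨DFinsupp.mk s fun i => z i, fun k => DFinsupp.ext fun i => ?_⟩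
  have h1 : (x k • (DFinsupp.mk s fun i => z i : DirectSum ι G)) i =
    x k • (DFinsupp.mk s fun i : s => z i : DirectSum ι G) i := rfl
  refine Eq.trans ?_ h1.symm
  change y k i = x k • (DFinsupp.mk s fun i : s => z i) i
  rw [DFinsupp.mk_apply]
  split_ifs with hi
  · exact hz i k
  · rw [smul_zero]
    by_contra h0
    exact hi (Finset.mem_biUnion.2 ⟨k, Finset.mem_univ _, DFinsupp.mem_support_iff.2 h0⟩)

/-- All modules of size at most 2^|Λ| are quotients of one free module. The coflat ones with a map
to M therefore form a set up to isomorphism, and their direct sum is a precover because every map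
factors through one of them. -/
theorem IsSemiregularCoherent.isPrecoveringClass (h : IsSemiregularCoherent R) :
    IsPrecoveringClass (semiregularCoflatClass R) := by
  classical
  intro M
  let Λ : Type u := ULift.{u} ℕ ⊕ (R ⊕ M)
  have hR : #R ≤ #Λ := mk_le_of_injective (f := fun r => Sum.inr (Sum.inl r))
    (Sum.inr_injective.comp Sum.inl_injective)
  have hM : #M ≤ #Λ := mk_le_of_injective (f := fun r => Sum.inr (Sum.inr r))
    (Sum.inr_injective.comp Sum.inr_injective)
  let T : Type u := Set Λ
  let I : Type u := Σ Q : Submodule R (T →₀ R), {_g : ((T →₀ R) ⧸ Q) →ₗ[R] M //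
    IsSemiregularCoflat R ((T →₀ R) ⧸ Q)}
  let G : I → Type u := fun i => (T →₀ R) ⧸ i.1
  let _ : ∀ i, AddCommGroup (G i) := fun i => inferInstanceAs (AddCommGroup ((T →₀ R) ⧸ i.1))
  let _ : ∀ i, Module R (G i) := fun i => inferInstanceAs (Module R ((T →₀ R) ⧸ i.1))
  refine ⟨ModuleCat.of R (DirectSum I G), ModuleCat.ofHom (DirectSum.toModule R I M fun i => i.2.1),
    isSemiregularCoflat_directSum fun i => i.2.2, fun F' g hF' => ?_⟩
  obtain ⟨P, hPg, hP, hcard⟩ := h.exists_small_quotient g.hom Λ hR hM hF'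
  rw [← mk_set] at hcard
  obtain ⟨e⟩ : Nonempty ((F' ⧸ P) ↪ T) := hcard
  let q : (T →₀ R) →ₗ[R] F' ⧸ P := Finsupp.linearCombination R (Function.invFun e)
  have hq : Function.Surjective q := fun y =>
    ⟨Finsupp.single (e y) 1, by simp [q, Function.leftInverse_invFun e.injective y]⟩
  let E : ((T →₀ R) ⧸ LinearMap.ker q) ≃ₗ[R] F' ⧸ P := q.quotKerEquivOfSurjective hq
  let i : I := ⟨LinearMap.ker q, (P.liftQ g.hom hPg).comp E.toLinearMap, hP.of_equiv E.symm⟩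
  refine ⟨ModuleCat.ofHom
    ((DirectSum.lof R I G i).comp (E.symm.toLinearMap.comp P.mkQ)), ?_⟩
  ext y
  change DirectSum.toModule R I M (fun i => i.2.1) (DirectSum.lof R I G i (E.symm (P.mkQ y))) = _
  rw [DirectSum.toModule_lof]
  simp [i]

end Precovers

/-! ### From precovers to covers -/

section Covers

open Cardinal Limits

variable {R : Type u} [CommRing R]

theorem DirectLimitsCoflat.of_isColimit (h : DirectLimitsCoflat R) {J : Type u} [LinearOrder J]
    [Nonempty J] {D : J ⥤ ModuleCat.{u} R} {c : Cocone D} (hc : IsColimit c)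
    (hD : ∀ j, IsSemiregularCoflat R (D.obj j)) : IsSemiregularCoflat R c.pt := by
  let f : ∀ i j, i ≤ j → D.obj i →ₗ[R] D.obj j := fun i j hij => (D.map (homOfLE hij)).hom
  have : DirectedSystem (fun j => D.obj j) (fun i j h => f i j h) := by
    refine ⟨fun i x => ?_, fun i j k hij hjk x => ?_⟩
    · exact congrArg (fun g => g.hom x) (D.map_id i)
    · exact (congrArg (fun g => g.hom x) (D.map_comp (homOfLE hij) (homOfLE hjk))).symm
  let ι (j : J) : D.obj j ⟶ ModuleCat.of R (Module.DirectLimit (fun j => D.obj j) f) :=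
    ModuleCat.ofHom (Module.DirectLimit.of R J (fun j => D.obj j) f j)
  have hι (i j : J) (hij : i ⟶ j) : D.map hij ≫ ι j = ι i := by
    ext x
    exact Module.DirectLimit.of_f (f := f) (hij := leOfHom hij)
  let s : Cocone D := ⟨_, ι, fun i j hij => (hι i j hij).trans (Category.comp_id _).symm⟩
  let p : Module.DirectLimit (fun j => D.obj j) f →ₗ[R] c.pt :=
    Module.DirectLimit.lift R J _ f (fun j => (c.ι.app j).hom) fun i j hij x =>
      congrArg (fun g => g.hom x) (c.w (homOfLE hij))
  have hp : hc.desc s ≫ ModuleCat.ofHom p = 𝟙 _ := hc.hom_ext fun j => by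
    rw [hc.fac_assoc, Category.comp_id]
    ext x
    change p (Module.DirectLimit.of R J (fun j => D.obj j) f j x) = _
    simp only [p, Module.DirectLimit.lift_of]
  exact (h J (fun j => D.obj j) f hD).of_retract (hc.desc s).hom p
    fun m => congrArg (fun g => g.hom m) hp

/-- In a long enough continuous chain with small successor stages, the map from some limit stage to
the colimit is injective. -/
theorem exists_injective_stage {J : Type u} [LinearOrder J] [SuccOrder J] [WellFoundedLT J]
    [NoMaxOrder J] {μ : Cardinal.{u}} (hμ : ℵ₀ ≤ μ)
    (hJ : ∀ (K : Type u) (s : K → J), #K ≤ μ → ∃ j, ∀ k, s k ≤ j)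
    {D : J ⥤ ModuleCat.{u} R} {c : Cocone D} (hc : IsColimit c)
    (hsmall : ∀ j, #(D.obj (Order.succ j)) ≤ μ)
    (hlim : ∀ m, Order.IsSuccLimit m → ∀ x : D.obj m, ∃ (i : J) (hi : i < m) (y : D.obj i),
      (D.map (homOfLE hi.le)).hom y = x) (j₀ : J) :
    ∃ δ, j₀ ≤ δ ∧ Function.Injective (c.ι.app δ).hom := by
  have : Nonempty J := ⟨j₀⟩
  have hβ : ∀ j, ∃ (k : J) (hk : Order.succ j ≤ k), ∀ x : D.obj (Order.succ j),
      (c.ι.app (Order.succ j)).hom x = 0 → (D.map (homOfLE hk)).hom x = 0 := fun j => by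
    have h1 : ∀ x : {x : D.obj (Order.succ j) // (c.ι.app (Order.succ j)).hom x = 0},
        ∃ (k : J) (hk : Order.succ j ≤ k), (D.map (homOfLE hk)).hom x.1 = 0 := fun x => by
      obtain ⟨k, f, g, hfg⟩ := Concrete.isColimit_exists_of_rep_eq D hc x.1
        (0 : D.obj (Order.succ j)) (x.2.trans (map_zero _).symm)
      exact ⟨k, leOfHom f, hfg.trans (map_zero _)⟩
    choose k hk hk0 using h1
    obtain ⟨l, hl⟩ := hJ _ k ((mk_subtype_le _).trans (hsmall j))
    refine ⟨max l (Order.succ j), le_max_right _ _, fun x hx => ?_⟩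
    have h2 : (homOfLE (le_max_right l (Order.succ j))) =
      homOfLE (hk ⟨x, hx⟩) ≫ homOfLE ((hl ⟨x, hx⟩).trans (le_max_left _ _)) := rfl
    rw [h2, D.map_comp, ModuleCat.hom_comp, LinearMap.comp_apply, hk0 ⟨x, hx⟩, map_zero]
  choose β hβ hβ0 using hβ
  -- Let δ be the supremum of the ω iterates of β. An element at δ comes from below some `a n`. If
  -- it dies in the colimit, then seen at the successor of `a n` it dies by stage β (a n) ≤ δ.
  let a : ℕ → J := fun n => β^[n] j₀
  have ha : ∀ n, a (n + 1) = β (a n) := fun n => Function.iterate_succ_apply' β n j₀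
  have halt : ∀ n, a n < a (n + 1) := fun n =>
    (Order.lt_succ (a n)).trans_le ((hβ (a n)).trans_eq (ha n).symm)
  let U : Set J := {j | ∀ n, a n ≤ j}
  have hU : U.Nonempty := by
    obtain ⟨j, hj⟩ := hJ (ULift.{u} ℕ) (fun n => a n.down) (by simpa using hμ)
    exact ⟨j, fun n => hj ⟨n⟩⟩
  let δ := wellFounded_lt.min U hU
  have hδ : ∀ n, a n ≤ δ := wellFounded_lt.min_mem U hU
  have hδ' : ∀ i < δ, ∃ n, i < a n := fun i hi => by
    by_contra! h
    exact wellFounded_lt.not_lt_min U h hi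
  have hδlim : Order.IsSuccLimit δ := by
    refine ⟨fun h => ?_, fun i hi => ?_⟩
    · exact (h (hδ 0)).not_gt ((halt 0).trans_le (hδ 1))
    · obtain ⟨n, hn⟩ := hδ' i hi.lt
      exact hi.2 hn ((halt n).trans_le (hδ _))
  refine ⟨δ, hδ 0, (injective_iff_map_eq_zero _).2 fun x hx => ?_⟩
  obtain ⟨i, hi, y, rfl⟩ := hlim δ hδlim x
  obtain ⟨n, hn⟩ := hδ' i hi
  have h1 : i ≤ Order.succ (a n) := hn.le.trans (Order.le_succ _)
  have h2 : β (a n) ≤ δ := (ha n).symm.trans_le (hδ _)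
  have h3 : homOfLE hi.le = homOfLE h1 ≫ homOfLE (hβ (a n)) ≫ homOfLE h2 := rfl
  have h4 := hβ0 (a n) ((D.map (homOfLE h1)).hom y) (by
    have h5 := congrArg (fun g => g.hom y) (c.w (homOfLE h1))
    have h6 := congrArg (fun g => g.hom y) (c.w (homOfLE hi.le))
    exact h5.trans (h6.symm.trans hx))
  rw [h3, D.map_comp, D.map_comp, ModuleCat.hom_comp, ModuleCat.hom_comp, LinearMap.comp_apply,
    LinearMap.comp_apply, h4, map_zero]

/-- Among the morphisms `X ⟶ P` over `M`, there is one that is non-injective if possible, and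
otherwise not a split monomorphism if possible. -/
theorem Over.exists_worst_hom {M : ModuleCat.{u} R} {X P : Over M} (h : Nonempty (X ⟶ P)) :
    ∃ v : X ⟶ P, (Function.Injective v.left.hom → ∀ w : X ⟶ P, Function.Injective w.left.hom) ∧
      (Function.Injective v.left.hom → IsSplitMono v → ∀ w : X ⟶ P, IsSplitMono w) := by
  by_cases h1 : ∃ v : X ⟶ P, ¬ Function.Injective v.left.hom
  · obtain ⟨v, hv⟩ := h1
    exact ⟨v, fun h => absurd h hv, fun h => absurd h hv⟩
  · push Not at h1
    by_cases h2 : ∃ v : X ⟶ P, ¬ IsSplitMono v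
    · obtain ⟨v, hv⟩ := h2
      exact ⟨v, fun _ => h1, fun _ h => absurd h hv⟩
    · push Not at h2
      exact ⟨h.some, fun _ => h1, fun _ _ => h2⟩

open Classical in
/-- The successor structure mapping an object over `M` to `P` by a worst possible morphism. -/
noncomputable def worstSuccStruct {M : ModuleCat.{u} R} (P : Over M) :
    SmallObject.SuccStruct (Over M) where
  X₀ := P
  succ X := if Nonempty (X ⟶ P) then P else X
  toSucc X := if h : Nonempty (X ⟶ P) then
    (Over.exists_worst_hom h).choose ≫ eqToHom (if_pos h).symm else eqToHom (if_neg h).symm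

theorem worstSuccStruct_succ {M : ModuleCat.{u} R} {P X : Over M} (h : Nonempty (X ⟶ P)) :
    (worstSuccStruct P).succ X = P := if_pos h

theorem worstSuccStruct_toSucc {M : ModuleCat.{u} R} {P X : Over M} (h : Nonempty (X ⟶ P)) :
    (worstSuccStruct P).toSucc X =
      (Over.exists_worst_hom h).choose ≫ eqToHom (worstSuccStruct_succ h).symm := dif_pos h

/-- Every endomorphism of X over M is split, as seen by composing it with a map to the precover. Its
retraction is again an endomorphism, hence also split, so both are invertible. -/
theorem isCover_of_forall_isSplitMono {C : ObjectProperty (ModuleCat.{u} R)}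
    {F M : ModuleCat.{u} R} {f : F ⟶ M} (hf : IsPrecover C f) {X : Over M} (hX : C X.left)
    (a : Over.mk f ⟶ X) (hsplit : ∀ w : X ⟶ Over.mk f, IsSplitMono w) : IsCover C X.hom := by
  refine ⟨⟨hX, fun F' g hF' => ?_⟩, fun h hh => ?_⟩
  · obtain ⟨k, hk⟩ := hf.2 F' g hF'
    exact ⟨k ≫ a.left, by rw [Category.assoc, Over.w a]; exact hk⟩
  · obtain ⟨b, hb⟩ := hf.2 _ X.hom hX
    let b' : X ⟶ Over.mk f := Over.homMk b hb
    have hend : ∀ e : X ⟶ X, ∃ r : X ⟶ X, e ≫ r = 𝟙 X := fun e => by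
      have := hsplit (e ≫ b')
      exact ⟨b' ≫ retraction (e ≫ b'), by rw [← Category.assoc, IsSplitMono.id]⟩
    let e : X ⟶ X := Over.homMk h hh
    obtain ⟨r, hr⟩ := hend e
    obtain ⟨r', hr'⟩ := hend r
    have hre : r ≫ e = 𝟙 X := by
      have : e = r' := by
        calc e = e ≫ r ≫ r' := by rw [hr', Category.comp_id]
          _ = r' := by rw [← Category.assoc, hr, Category.id_comp]
      rw [this, hr']
    exact ⟨r.left, congrArg CommaMorphism.left hr, congrArg CommaMorphism.left hre⟩

/-- Iterate worst possible maps to the precover P. At a stage injecting into the colimit the worst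
map is injective, so every map from it to P over M is. This bounds the size of the colimit and makes
the chain reach it at some stage. There the worst map splits, so all maps to P split and that stage
is a cover. -/
theorem DirectLimitsCoflat.isCoveringClass (h : DirectLimitsCoflat R)
    (hpre : IsPrecoveringClass (semiregularCoflatClass R)) :
    IsCoveringClass (semiregularCoflatClass R) := by
  intro M
  obtain ⟨F, f, hf⟩ := hpre M
  let P : Over M := Over.mk f
  let μ : Cardinal.{u} := max ℵ₀ #F
  have hμ : ℵ₀ ≤ μ := le_max_left _ _
  have : Fact (Order.succ μ).IsRegular := ⟨isRegular_succ hμ⟩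
  -- A regular length above |F| makes any family of at most μ indices bounded.
  let J : Type u := (Order.succ μ).ord.ToType
  have hno : NoMaxOrder J := Cardinal.noMaxOrder (hμ.trans (Order.le_succ μ))
  have hne : Nonempty J := (Cardinal.mk_ne_zero_iff).1 (by
    rw [mk_ord_toType]
    exact (aleph0_pos.trans_le (hμ.trans (Order.le_succ μ))).ne')
  let _ : OrderBot J := WellFoundedLT.toOrderBot J
  let _ : SuccOrder J := SuccOrder.ofLinearWellFoundedLT J
  have hJ : ∀ (K : Type u) (s : K → J), #K ≤ μ → ∃ j, ∀ k, s k ≤ j := fun K s hK => by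
    have hlt : HasCardinalLT K (Order.succ μ) := by
      rw [hasCardinalLT_iff_cardinal_mk_lt]
      exact Order.lt_succ_of_le hK
    exact ⟨IsCardinalFiltered.max s hlt, fun k => leOfHom (IsCardinalFiltered.toMax s hlt k)⟩
  let S := worstSuccStruct P
  let Φ : J ⥤ Over M := S.iterationFunctor J
  let D : J ⥤ ModuleCat.{u} R := Φ ⋙ Over.forget M
  let c : Cocone D := (Over.forget M).mapCocone (S.iterationCocone J)
  have hc : IsColimit c := isColimitOfPreserves (Over.forget M) (S.isColimitIterationCocone J)
  have hmap : ∀ X : Over M, IsSemiregularCoflat R X.left → Nonempty (X ⟶ P) := fun X hX => by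
    obtain ⟨b, hb⟩ := hf.2 _ X.hom hX
    exact ⟨Over.homMk b hb⟩
  have hlim : ∀ m, Order.IsSuccLimit m →
      IsColimit ((Over.forget M).mapCocone ((Set.principalSegIio m).cocone Φ)) := fun m hm =>
    isColimitOfPreserves (Over.forget M) (Φ.isColimitOfIsWellOrderContinuous m hm)
  have hsucc : ∀ j, IsSemiregularCoflat R (D.obj j) → Φ.obj (Order.succ j) = P := fun j hj =>
    (S.prop_iterationFunctor_map_succ j (not_isMax j)).succ_eq.symm.trans
      (worstSuccStruct_succ (hmap _ hj))
  have hcoflat : ∀ j, IsSemiregularCoflat R (D.obj j) := fun j => by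
    induction j using SuccOrder.limitRecOn with
    | isMin j hj =>
      obtain rfl := hj.eq_bot
      exact IsSemiregularCoflat.of_equiv (N := F) hf.1
        ((Over.forget M).mapIso (S.iterationFunctorObjBotIso J).symm).toLinearEquiv
    | succ j _ ih =>
      have : D.obj (Order.succ j) = F := congrArg (fun X : Over M => X.left) (hsucc j ih)
      rw [this]
      exact hf.1
    | isSuccLimit j hj ih =>
      have : Nonempty (Set.Iio j) := hj.nonempty_Iio.to_subtype
      exact h.of_isColimit (hlim j hj) fun i => ih i.1 i.2
  have hsmall : ∀ j, #(D.obj (Order.succ j)) ≤ μ := fun j => by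
    have : D.obj (Order.succ j) = F :=
      congrArg (fun X : Over M => X.left) (hsucc j (hcoflat j))
    rw [this]
    exact le_max_right _ _
  have hstage := exists_injective_stage hμ hJ hc hsmall fun m hm x => by
    have : Nonempty (Set.Iio m) := hm.nonempty_Iio.to_subtype
    obtain ⟨i, y, hy⟩ := Concrete.isColimit_exists_rep _ (hlim m hm) x
    exact ⟨i.1, i.2, y, hy⟩
  have hG : IsSemiregularCoflat R c.pt := h.of_isColimit hc hcoflat
  obtain ⟨g⟩ := hmap (S.iterationCocone J).pt hG
  -- The worst map is a first factor of the map to the colimit, so injectivity or splitting of the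
  -- latter passes to it.
  have hv : ∀ δ, ∃ u : P ⟶ (S.iterationCocone J).pt,
      (Over.exists_worst_hom (hmap _ (hcoflat δ))).choose ≫ u = (S.iterationCocone J).ι.app δ :=
    fun δ => by
      have h1 := (S.iterationCocone J).w (homOfLE (Order.le_succ δ))
      have h2 : Φ.map (homOfLE (Order.le_succ δ)) = _ :=
        S.iterationFunctor_map_succ δ (not_isMax δ)
      rw [worstSuccStruct_toSucc (hmap _ (hcoflat δ))] at h2
      refine ⟨eqToHom (worstSuccStruct_succ (hmap _ (hcoflat δ))).symm ≫
        (S.iterationFunctorObjSuccIso δ (not_isMax δ)).inv ≫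
        (S.iterationCocone J).ι.app (Order.succ δ), ?_⟩
      rw [← h1]
      change _ = Φ.map (homOfLE (Order.le_succ δ)) ≫ _
      rw [h2, Category.assoc, Category.assoc]
  have hinj : ∀ δ, Function.Injective (c.ι.app δ).hom → ∀ w : Φ.obj δ ⟶ P,
      Function.Injective w.left.hom := fun δ hδ => by
    obtain ⟨u, hu⟩ := hv δ
    refine (Over.exists_worst_hom (hmap _ (hcoflat δ))).choose_spec.1 ?_
    refine Function.Injective.of_comp (f := u.left.hom) ?_
    have h1 : c.ι.app δ = _ := (congrArg CommaMorphism.left hu).symm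
    rw [h1] at hδ
    exact hδ
  have hrep : ∀ x : c.pt, ∃ j, ∃ y : D.obj j, (c.ι.app j).hom y = x :=
    Concrete.isColimit_exists_rep D hc
  have hup : ∀ {i j : J} (hij : i ≤ j) (y : D.obj i),
      (c.ι.app j).hom ((D.map (homOfLE hij)).hom y) = (c.ι.app i).hom y := fun hij y =>
    congrArg (fun g => g.hom y) (c.w (homOfLE hij))
  have hginj : Function.Injective g.left.hom := by
    refine (injective_iff_map_eq_zero _).2 fun x hx => ?_
    obtain ⟨j, y, rfl⟩ := hrep x
    obtain ⟨δ, hjδ, hδ⟩ := hstage j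
    have h1 : (D.map (homOfLE hjδ)).hom y = 0 := by
      refine (injective_iff_map_eq_zero _).1
        (hinj δ hδ ((S.iterationCocone J).ι.app δ ≫ g)) _ ?_
      change g.left.hom ((c.ι.app δ).hom _) = 0
      rw [hup hjδ, hx]
    rw [← hup hjδ, h1]
    exact map_zero (c.ι.app δ).hom
  -- The colimit embeds in F, so representatives of all its elements occur before one bounded stage.
  -- A later injective stage is then also surjective.
  have hcard : #c.pt ≤ μ := (mk_le_of_injective hginj).trans (le_max_right _ _)
  choose s hs using hrep
  obtain ⟨j₁, hj₁⟩ := hJ c.pt s hcard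
  obtain ⟨δ, hδ₁, hδ⟩ := hstage j₁
  have hbij : Function.Bijective (c.ι.app δ).hom := ⟨hδ, fun x => by
    obtain ⟨y, hy⟩ := hs x
    exact ⟨(D.map (homOfLE ((hj₁ x).trans hδ₁))).hom y, (hup ((hj₁ x).trans hδ₁) y).trans hy⟩⟩
  have hiso : IsIso ((S.iterationCocone J).ι.app δ) := by
    have : IsIso ((Over.forget M).map ((S.iterationCocone J).ι.app δ)) :=
      (ConcreteCategory.isIso_iff_bijective (c.ι.app δ)).2 hbij
    exact isIso_of_reflects_iso _ (Over.forget M)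
  obtain ⟨u, hu⟩ := hv δ
  have hsplit : IsSplitMono (Over.exists_worst_hom (hmap _ (hcoflat δ))).choose :=
    ⟨⟨⟨u ≫ inv ((S.iterationCocone J).ι.app δ), by
      rw [← Category.assoc, hu, IsIso.hom_inv_id]⟩⟩⟩
  exact ⟨_, _, isCover_of_forall_isSplitMono hf (hcoflat δ) ((S.ιIterationFunctor J).app δ)
    ((Over.exists_worst_hom (hmap _ (hcoflat δ))).choose_spec.2 (hinj δ hδ _) hsplit)⟩

end Covers

/-! ### The equivalences -/

theorem theorem4p4 (R : Type u) [CommRing R] :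
    List.TFAE [
      IsSemiregularCoherent R,
      ∀ (ι : Type u) (F : ι → Type u) [∀ i, AddCommGroup (F i)] [∀ i, Module R (F i)],
        (∀ i, IsSemiregularFlat R (F i)) → IsSemiregularFlat R (∀ i, F i),
      ∀ (ι : Type u) (F : ι → Type u) [∀ i, AddCommGroup (F i)] [∀ i, Module R (F i)],
        (∀ i, Module.Flat R (F i)) → IsSemiregularFlat R (∀ i, F i),
      ∀ ι : Type u, IsSemiregularFlat R (ι → R),
      ∀ (ι : Type u) [DecidableEq ι] [Preorder ι] [IsDirectedOrder ι] [Nonempty ι]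
        (G : ι → Type u) [∀ i, AddCommGroup (G i)] [∀ i, Module R (G i)]
        (f : ∀ i j, i ≤ j → G i →ₗ[R] G j) [DirectedSystem G (fun i j h => f i j h)],
        (∀ i, IsSemiregularCoflat R (G i)) → IsSemiregularCoflat R (Module.DirectLimit G f),
      ∀ (N : Type u) [AddCommGroup N] [Module R N] (K : Submodule R N),
        IsSemiregularCoflat R N → K.IsPureSubmodule → IsSemiregularCoflat R (N ⧸ K),
      IsPrecoveringClass (semiregularCoflatClass R),
      IsCoveringClass (semiregularCoflatClass R),
      ∀ (N E : Type u) [AddCommGroup N] [Module R N] [AddCommGroup E] [Module R E],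
        IsSemiregularCoflat R N → Module.Injective R E → IsSemiregularFlat R (N →ₗ[R] E),
      ∀ (E : Type u) [AddCommGroup E] [Module R E], IsInjectiveCogenerator R E →
        ∀ (N : Type u) [AddCommGroup N] [Module R N],
          IsSemiregularCoflat R N → IsSemiregularFlat R (N →ₗ[R] E),
      ∀ (M E₁ E₂ : Type u) [AddCommGroup M] [Module R M] [AddCommGroup E₁] [Module R E₁]
        [AddCommGroup E₂] [Module R E₂],
        IsSemiregularFlat R M → Module.Injective R E₁ → Module.Injective R E₂ →
          IsSemiregularFlat R ((M →ₗ[R] E₁) →ₗ[R] E₂),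
      ∀ (E₁ E₂ : Type u) [AddCommGroup E₁] [Module R E₁] [AddCommGroup E₂] [Module R E₂],
        IsInjectiveCogenerator R E₁ → IsInjectiveCogenerator R E₂ →
        ∀ (M : Type u) [AddCommGroup M] [Module R M],
          IsSemiregularFlat R M → IsSemiregularFlat R ((M →ₗ[R] E₁) →ₗ[R] E₂)] := by
  tfae_have 1 → 2 := fun h ι F _ _ hF => h.isSemiregularFlat_pi F hF
  tfae_have 2 → 3 := fun h ι F _ _ hF => h ι F fun i =>
    have := hF i
    isSemiregularFlat_iff.2 fun n x _ => trivializesRelations_of_flat x _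
  tfae_have 3 → 4 := fun h ι => h ι (fun _ => R) fun _ => inferInstance
  tfae_have 4 → 1 := fun h => isSemiregularCoherent_of_pi_flat h
  tfae_have 1 → 5 := fun h => h.directLimitsCoflat
  tfae_have 5 → 1 := fun h =>
    have h' : DirectLimitsCoflat R := h
    h'.reducedProductsCoflat.isSemiregularCoherent
  tfae_have 1 → 6 := fun h N _ _ K hN hK =>
    h.isSemiregularCoflat_quotient hN hK.isEquationallyPure
  tfae_have 6 → 1 := fun h => (reducedProductsCoflat_of_pure_quotient h).isSemiregularCoherent
  tfae_have 1 → 8 := fun h => h.directLimitsCoflat.isCoveringClass h.isPrecoveringClass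
  tfae_have 8 → 7 := fun h M =>
    have ⟨F, f, hf⟩ := h M
    ⟨F, f, hf.1⟩
  tfae_have 7 → 1 := fun h => h.reducedProductsCoflat.isSemiregularCoherent
  tfae_have 1 → 9 := fun h N E _ _ _ _ hN hE => h.isSemiregularFlat_hom hN hE
  tfae_have 9 → 10 := fun h E _ _ hE N _ _ hN => h N E hN hE.1
  tfae_have 10 → 12 := fun h E₁ E₂ _ _ _ _ hE₁ hE₂ M _ _ hM =>
    h E₂ hE₂ _ (hM.isSemiregularCoflat_hom hE₁.1)
  tfae_have 12 → 4 := fun h => isSemiregularFlat_pi_of_bidual fun M _ _ hM =>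
    h _ _ isInjectiveCogenerator_characterModule isInjectiveCogenerator_characterModule M hM
  tfae_have 9 → 11 := fun h M E₁ E₂ _ _ _ _ _ _ hM hE₁ hE₂ =>
    h _ E₂ (hM.isSemiregularCoflat_hom hE₁) hE₂
  tfae_have 11 → 12 := fun h E₁ E₂ _ _ _ _ hE₁ hE₂ M _ _ hM => h M E₁ E₂ hM hE₁.1 hE₂.1
  tfae_finish
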